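/- Let $0<\alpha<1$ and $0<p<1$ be fixed, and put $q=1-p$. For each $n$, consider the trie formed by $n$ independent random infinite binary strings, where the bits of each string are independent with $\mathbb{P}(1)=p$ and $\mathbb{P}(0)=q$. A node at level $k$ is labelled by a word $r\in\{0,1\}^k$, and it is an internal (filled) node if at least two of the $n$ strings begin with $r$. Let $X_k$ be the number of internal nodes at level $k$, let $\overline{X}_k=X_k/2^k$, and let $F_n(\alpha)=\max\{k:\overline{X}_k\ge\alpha\}$ be the $\alpha$-fillup level (well defined for $n\ge2$). Let $\Phi$ denote the standard normal distribution function. Then for each $n$ there is an integer $k_n\ge 0$ such that, as $n\to\infty$, $$k_n=\log_{1/\sqrt{pq}} n-\frac{|\ln(p/q)|}{2\,\bigl(\ln(1/\sqrt{pq})\bigr)^{3/2}}\,\Phi^{-1}(\alpha)\,\sqrt{\ln n}+O(1)$$ and $$\mathbb{P}\bigl(F_n(\alpha)\in\{k_n,\,k_n+1\}\bigr)\to 1 .$$ Moreover, if $p\ne 1/2$, then the same $k_n$ satisfy $$\mathbb{E}\,\overline{X}_{k_n}=\alpha+O\bigl(1/\sqrt{\log_2 n}\bigr)\qquad\text{as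 } n\to\infty .$$ The implied constants may depend on $\alpha$ and $p$. -/

import Mathlib

open MeasureTheory ProbabilityTheory Filter Topology Asymptotics

namespace Trie

noncomputable section

/-- The law of one infinite binary string from a memoryless source: the bits are independent,
each equal to `1` (`true`) with probability `p` and to `0` (`false`) with probability `1 - p`. -/
def stringLaw (p : unitInterval) : Measure (ℕ → Bool) :=
  Measure.infinitePi fun _ : ℕ => bernoulliMeasure true false p

instance (p : unitInterval) : IsProbabilityMeasure (stringLaw p) := by
  unfold stringLaw
  infer_instance

/-- The law of `n` independent random strings. -/
def sampleLaw (p : unitInterval) (n : ℕ) : Measure (Fin n → ℕ → Bool) :=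
  Measure.pi fun _ : Fin n => stringLaw p

instance (p : unitInterval) (n : ℕ) : IsProbabilityMeasure (sampleLaw p n) := by
  unfold sampleLaw
  infer_instance

/-- The word `r` of length `k` is a prefix of the infinite string `x`. -/
def IsPrefix {k : ℕ} (r : Fin k → Bool) (x : ℕ → Bool) : Prop :=
  ∀ j : Fin k, x j = r j

/-- The word `r` of length `k` labels an internal (filled) node at level `k` of the trie built
from the strings `s`: at least two of the inserted strings begin with `r`. -/
def IsInternalNode {n k : ℕ} (s : Fin n → ℕ → Bool) (r : Fin k → Bool) : Prop :=
  ∃ i j : Fin n, i ≠ j ∧ IsPrefix r (s i) ∧ IsPrefix r (s j)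

/-- `X_k`: the number of internal nodes at level `k`. -/
def internalCount {n : ℕ} (s : Fin n → ℕ → Bool) (k : ℕ) : ℕ :=
  Nat.card {r : Fin k → Bool // IsInternalNode s r}

/-- `X_k / 2 ^ k`: the proportion of nodes filled at level `k`. -/
def fillProportion {n : ℕ} (s : Fin n → ℕ → Bool) (k : ℕ) : ℝ :=
  (internalCount s k : ℝ) / 2 ^ k

/-- The `α`-fillup level: the last level at which at least a proportion `α` of the nodes is filled.
For `0 < α ≤ 1` and at least two strings this is a genuine maximum (`isGreatest_fillupLevel`). -/
def fillupLevel {n : ℕ} (α : ℝ) (s : Fin n → ℕ → Bool) : ℕ :=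
  sSup {k : ℕ | α ≤ fillProportion s k}

/-- The standard normal distribution function `Φ`. -/
def normalCDF (x : ℝ) : ℝ := cdf (gaussianReal 0 1) x

/-- The inverse `Φ⁻¹` of the standard normal distribution function, meaningful on `(0, 1)`
(`normalCDF_normalQuantile`). -/
def normalQuantile : ℝ → ℝ := Function.invFun normalCDF

theorem internalCount_le {n : ℕ} (s : Fin n → ℕ → Bool) (k : ℕ) : internalCount s k ≤ n := by
  classical
  have h : ∀ r : {r : Fin k → Bool // IsInternalNode s r}, ∃ i, IsPrefix r.1 (s i) :=
    fun r => let ⟨i, _, _, hi, _⟩ := r.2; ⟨i, hi⟩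
  choose f hf using h
  have hinj : Function.Injective f := by
    intro a b hab
    apply Subtype.ext
    funext j
    rw [← hf a j, ← hf b j, hab]
  simpa [internalCount] using Nat.card_le_card_of_injective f hinj

theorem isGreatest_fillupLevel {n : ℕ} (hn : 2 ≤ n) {α : ℝ} (h0 : 0 < α) (h1 : α ≤ 1)
    (s : Fin n → ℕ → Bool) :
    IsGreatest {k : ℕ | α ≤ fillProportion s k} (fillupLevel α s) := by
  have hne : {k : ℕ | α ≤ fillProportion s k}.Nonempty := by
    refine ⟨0, ?_⟩
    have hroot : IsInternalNode s (k := 0) (fun _ => true) :=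
      ⟨⟨0, by omega⟩, ⟨1, by omega⟩, by simp, fun j => j.elim0, fun j => j.elim0⟩
    have : 0 < internalCount s 0 := by
      have : Nonempty {r : Fin 0 → Bool // IsInternalNode s r} := ⟨⟨_, hroot⟩⟩
      exact Nat.card_pos
    have h2 : (1 : ℝ) ≤ internalCount s 0 := by exact_mod_cast this
    simp only [Set.mem_ofPred_eq, fillProportion, pow_zero, div_one]
    linarith
  have hbdd : BddAbove {k : ℕ | α ≤ fillProportion s k} := by
    obtain ⟨m, hm⟩ := pow_unbounded_of_one_lt ((n : ℝ) / α) (one_lt_two)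
    refine ⟨m, fun k hk => ?_⟩
    by_contra! hlt
    have hk' : α * 2 ^ k ≤ n := by
      have := (le_div_iff₀ (by positivity)).1 (show α ≤ (internalCount s k : ℝ) / 2 ^ k from hk)
      exact this.trans (by exact_mod_cast internalCount_le s k)
    have hpow : (2 : ℝ) ^ m ≤ 2 ^ k := pow_le_pow_right₀ one_le_two hlt.le
    rw [div_lt_iff₀ h0] at hm
    nlinarith
  exact ⟨Nat.sSup_mem hne hbdd, fun k hk => le_csSup hbdd hk⟩

theorem normalCDF_normalQuantile {α : ℝ} (h0 : 0 < α) (h1 : α < 1) :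
    normalCDF (normalQuantile α) = α := by
  apply Function.invFun_eq
  have hc : Continuous normalCDF := by
    have := nullSingletonClass_gaussianReal (μ := 0) (v := 1) one_ne_zero
    rw [continuous_iff_continuousAt]
    intro x
    have hm := (cdf (gaussianReal 0 1)).measure_singleton x
    rw [measure_cdf, measure_singleton, eq_comm, ENNReal.ofReal_eq_zero] at hm
    have hl : Function.leftLim (cdf (gaussianReal 0 1)) x = cdf (gaussianReal 0 1) x :=
      le_antisymm ((monotone_cdf _).leftLim_le le_rfl) (by linarith)
    exact (monotone_cdf (gaussianReal 0 1)).continuousAt_iff_leftLim_eq_rightLim.2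
      (by rw [hl, StieltjesFunction.rightLim_eq])
  obtain ⟨a, ha⟩ := ((tendsto_cdf_atBot (gaussianReal 0 1)).eventually_lt_const h0).exists
  obtain ⟨b, hb⟩ := ((tendsto_cdf_atTop (gaussianReal 0 1)).eventually_const_lt h1).exists
  exact mem_range_of_exists_le_of_exists_ge hc ⟨a, ha.le⟩ ⟨b, hb.le⟩

end

end Trie

/-!
Put `q = 1 - p`. The cell of a word of probability `x` is internal with probability
`1 - (1 - x) ^ n - n * x * (1 - x) ^ (n - 1)`, which differs from the indicator of `1 ≤ n * x` by
at most `9 * exp (-|log (n * x)|)`. For a uniformly chosen word of length `k`, the number of ones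
is symmetric binomial and `log (n * x)` is affine in it, so when `p ≠ 1 / 2` upper bounds of order
`1 / √k` on the binomial weights and the normal approximation give the mean fill proportion as
`Φ (score) + O (1 / √log n)` with a score affine in `k`. Matching lower bounds on the weights show
that near the crossing of `α` each level lowers the mean by at least a constant times
`1 / √log n`, hence by `2 / log n`; the last level where the mean is at least `α + 1 / log n` is
therefore followed within two levels by a mean of at most `α - 1 / log n`. When `p = 1 / 2` all
cells of a level are alike and a single level already lowers the mean by a constant.

The number of internal nodes is a sum over cells in which each string influences only the cells
for which it is pivotal, so by the Efron–Stein inequality its variance is at most `2 * 2 ^ k`.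
Chebyshev's inequality then keeps the fill proportions at levels `k` and `k + 2` within `1 / log n`
of their means, and since the fill proportion decreases with the level, the fillup level is `k` or
`k + 1`.
-/

namespace Trie

/-! ### The standard normal distribution function -/

theorem gaussianPDFReal_zero_one (x : ℝ) :
    gaussianPDFReal 0 1 x = (√(2 * Real.pi))⁻¹ * Real.exp (-x ^ 2 / 2) := by
  simp [gaussianPDFReal_def]

theorem continuous_gaussianPDFReal_zero_one : Continuous (gaussianPDFReal 0 1) := by
  rw [funext gaussianPDFReal_zero_one]
  fun_prop

theorem gaussianPDFReal_zero_one_le_one (x : ℝ) : gaussianPDFReal 0 1 x ≤ 1 := by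
  have hconst : (√(2 * Real.pi))⁻¹ ≤ 1 :=
    inv_le_one_of_one_le₀ (Real.one_le_sqrt.2 (by linarith [Real.pi_gt_three]))
  have hexp : Real.exp (-x ^ 2 / 2) ≤ 1 :=
    Real.exp_le_one_iff.2 (by linarith [sq_nonneg x])
  rw [gaussianPDFReal_zero_one]
  exact mul_le_one₀ hconst (Real.exp_nonneg _) hexp

theorem normalCDF_sub_eq_integral (x y : ℝ) :
    normalCDF y - normalCDF x = ∫ t in x..y, gaussianPDFReal 0 1 t := by
  have hintegrable : Integrable (gaussianPDFReal 0 1) := integrable_gaussianPDFReal 0 1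
  have hcdf : ∀ z, normalCDF z = ∫ t in Set.Iic z, gaussianPDFReal 0 1 t := fun z => by
    rw [normalCDF, cdf_eq_real, measureReal_def, gaussianReal_apply_eq_integral _ one_ne_zero,
      ENNReal.toReal_ofReal (integral_nonneg (gaussianPDFReal_nonneg _ _))]
  rw [hcdf, hcdf, intervalIntegral.integral_Iic_sub_Iic hintegrable.integrableOn
    hintegrable.integrableOn]

theorem abs_normalCDF_sub_le (x y : ℝ) : |normalCDF x - normalCDF y| ≤ |x - y| := by
  have hpdf : ∀ t, ‖gaussianPDFReal 0 1 t‖ ≤ 1 := fun t => by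
    rw [Real.norm_of_nonneg (gaussianPDFReal_nonneg _ _ _)]
    exact gaussianPDFReal_zero_one_le_one t
  rw [normalCDF_sub_eq_integral, ← one_mul |x - y|]
  exact intervalIntegral.norm_integral_le_of_norm_le_const fun t _ => hpdf t

theorem le_normalCDF_sub {A x y : ℝ} (hx : -A ≤ x) (hxy : x ≤ y) (hy : y ≤ A) :
    gaussianPDFReal 0 1 A * (y - x) ≤ normalCDF y - normalCDF x := by
  have hpdf : ∀ t ∈ Set.Icc x y, gaussianPDFReal 0 1 A ≤ gaussianPDFReal 0 1 t := fun t ht => by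
    rw [gaussianPDFReal_zero_one, gaussianPDFReal_zero_one]
    have : t ^ 2 ≤ A ^ 2 := sq_le_sq' (hx.trans ht.1) (ht.2.trans hy)
    gcongr
  rw [normalCDF_sub_eq_integral]
  have hintegrable := continuous_gaussianPDFReal_zero_one.intervalIntegrable (μ := volume) x y
  simpa [mul_comm] using
    intervalIntegral.integral_mono_on hxy intervalIntegrable_const hintegrable hpdf

theorem normalCDF_neg (x : ℝ) : normalCDF (-x) = 1 - normalCDF x := by
  have := nullSingletonClass_gaussianReal (μ := 0) (v := 1) one_ne_zero
  have hmap : (gaussianReal 0 1).map (fun t => -t) = gaussianReal 0 1 := by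
    rw [gaussianReal_map_neg, neg_zero]
  have hreflect : (gaussianReal 0 1).real (Set.Iic (-x)) = (gaussianReal 0 1).real (Set.Ici x) := by
    conv_lhs => rw [← hmap, map_measureReal_apply measurable_neg measurableSet_Iic]
    congr 1
    ext t
    simp
  rw [normalCDF, normalCDF, cdf_eq_real, cdf_eq_real, hreflect, ← Set.compl_Iio,
    probReal_compl_eq_one_sub measurableSet_Iio, measureReal_congr Iio_ae_eq_Iic]

theorem normalCDF_zero : normalCDF 0 = 1 / 2 := by
  have := normalCDF_neg 0
  rw [neg_zero] at this
  linarith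

/-! ### The symmetric binomial distribution -/

noncomputable section

/-- The probability that a symmetric binomial variable with `k` trials equals `j`. -/
def binomProb (k j : ℕ) : ℝ := (k.choose j : ℝ) / 2 ^ k

/-- The normal approximation to `binomProb (2 * m) (m + t)`: the density at `t` of the centred
normal law of variance `m / 2`. -/
def gaussianProfile (m : ℕ) (t : ℝ) : ℝ := Real.exp (-t ^ 2 / m) / √(Real.pi * m)

/-- The probability that a symmetric binomial variable with `k` trials is at least `N`. -/
def binomTail (k N : ℕ) : ℝ := ∑ j ∈ Finset.Ico N (k + 1), binomProb k j

end

theorem binomProb_nonneg (k j : ℕ) : 0 ≤ binomProb k j := by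
  unfold binomProb; positivity

theorem sum_binomProb (k : ℕ) : ∑ j ∈ Finset.range (k + 1), binomProb k j = 1 := by
  simp only [binomProb, ← Finset.sum_div]
  rw [div_eq_one_iff_eq (by positivity)]
  exact_mod_cast Nat.sum_range_choose k

theorem binomProb_symm {k j : ℕ} (h : j ≤ k) : binomProb k (k - j) = binomProb k j := by
  rw [binomProb, binomProb, Nat.choose_symm h]

theorem half_binomProb_le_succ (k j : ℕ) : binomProb k j / 2 ≤ binomProb (k + 1) j := by
  have h : (k.choose j : ℝ) ≤ (k + 1).choose j := by
    exact_mod_cast Nat.choose_le_choose j k.le_succ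
  rw [binomProb, binomProb, pow_succ, div_div]
  gcongr

theorem binomProb_le_middle (k j : ℕ) : binomProb k j ≤ binomProb k (k / 2) := by
  unfold binomProb
  gcongr
  exact Nat.choose_le_middle j k

theorem sq_binomProb_central_mul_wallis (m : ℕ) :
    binomProb (2 * m) m ^ 2 * (Real.Wallis.W m * (2 * m + 1)) = 1 := by
  have hchoose : ((2 * m).choose m : ℝ) * m.factorial ^ 2 = (2 * m).factorial := by
    have h := Nat.choose_mul_factorial_mul_factorial (show m ≤ 2 * m by lia)
    rw [show 2 * m - m = m by lia, mul_assoc, ← sq] at h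
    exact_mod_cast h
  have hpow : (2 : ℝ) ^ (4 * m) = (2 ^ (2 * m)) ^ 2 := by rw [← pow_mul]; ring_nf
  have hfact : ((2 * m).factorial : ℝ) ≠ 0 := by positivity
  rw [Real.Wallis.W_eq_factorial_ratio, binomProb, hpow]
  field_simp
  rw [← hchoose]
  ring

theorem binomProb_central_mul_sqrt_le_one (m : ℕ) :
    binomProb (2 * m) m * √(Real.pi * m) ≤ 1 := by
  have hpi := Real.pi_pos
  have hW : Real.pi * m ≤ Real.Wallis.W m * (2 * m + 1) := by
    refine le_trans ?_ (mul_le_mul_of_nonneg_right (Real.Wallis.le_W m) (by positivity))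
    rw [div_mul_eq_mul_div, div_mul_eq_mul_div, le_div_iff₀ (by positivity)]
    nlinarith
  rw [← sq_le_one_iff₀ (mul_nonneg (binomProb_nonneg _ _) (Real.sqrt_nonneg _)), mul_pow,
    Real.sq_sqrt (by positivity), ← sq_binomProb_central_mul_wallis m]
  gcongr

theorem exp_neg_inv_le_binomProb_central_mul_sqrt {m : ℕ} (hm : 0 < m) :
    Real.exp (-(1 / m)) ≤ binomProb (2 * m) m * √(Real.pi * m) := by
  have hle := binomProb_central_mul_sqrt_le_one m
  have hy0 : 0 ≤ binomProb (2 * m) m * √(Real.pi * m) :=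
    mul_nonneg (binomProb_nonneg _ _) (Real.sqrt_nonneg _)
  have hsq : 1 ≤ (binomProb (2 * m) m * √(Real.pi * m)) ^ 2 * (1 + 1 / (2 * m)) := by
    have hW : Real.Wallis.W m * (2 * m + 1) ≤ Real.pi * m * (1 + 1 / (2 * m)) := by
      refine (mul_le_mul_of_nonneg_right (Real.Wallis.W_le m) (by positivity)).trans_eq ?_
      field_simp
    rw [mul_pow, Real.sq_sqrt (by positivity), mul_assoc]
    exact (sq_binomProb_central_mul_wallis m).symm.trans_le (by gcongr)
  have hexp : 1 + 1 / (2 * m) ≤ Real.exp (1 / m) := by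
    have : 1 / (2 * m : ℝ) ≤ 1 / m := one_div_le_one_div_of_le (by positivity) (by linarith)
    linarith [Real.add_one_le_exp (1 / m : ℝ)]
  rw [Real.exp_neg, inv_le_iff_one_le_mul₀ (Real.exp_pos _)]
  calc 1 ≤ (binomProb (2 * m) m * √(Real.pi * m)) ^ 2 * (1 + 1 / (2 * m)) := hsq
    _ ≤ binomProb (2 * m) m * √(Real.pi * m) * Real.exp (1 / m) := by
      gcongr
      exact pow_le_of_le_one hy0 hle two_ne_zero

theorem binomProb_succ_mul {m j : ℕ} (hm : 0 < m) (hj : j ≤ m) :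
    binomProb (2 * m) (m + (j + 1)) * (1 + (j + 1) / m) =
      binomProb (2 * m) (m + j) * (1 - j / m) := by
  have h := Nat.choose_succ_right_eq (2 * m) (m + j)
  rw [show 2 * m - (m + j) = m - j by lia] at h
  have h' := congrArg (Nat.cast : ℕ → ℝ) h
  push_cast [Nat.cast_sub hj] at h'
  rw [binomProb, binomProb, ← add_assoc]
  field_simp
  linear_combination h'

theorem exp_one_sub_inv_le {x : ℝ} (hx : 0 < x) : Real.exp (1 - x⁻¹) ≤ x :=
  (Real.le_log_iff_exp_le hx).1 (Real.one_sub_inv_le_log_of_pos hx)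

theorem exp_mul_one_add_le_one_sub {u v : ℝ} (hu0 : 0 ≤ u) (hu : u ≤ 1 / 2) (hv : 0 ≤ v) :
    Real.exp (-(u + v) - 2 * (u ^ 2 + u * v + v ^ 2)) * (1 + v) ≤ 1 - u := by
  have hinv : -u - 2 * u ^ 2 ≤ 1 - (1 - u)⁻¹ := by
    rw [le_sub_comm, inv_le_iff_one_le_mul₀ (by linarith)]
    nlinarith [mul_nonneg (sq_nonneg u) (sub_nonneg.2 hu)]
  calc _ ≤ Real.exp (-(u + v) - 2 * (u ^ 2 + u * v + v ^ 2)) * Real.exp v := by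
        gcongr
        linarith [Real.add_one_le_exp v]
    _ ≤ Real.exp (1 - (1 - u)⁻¹) := by
        rw [← Real.exp_add, Real.exp_le_exp]
        nlinarith [mul_nonneg hu0 hv, sq_nonneg v]
    _ ≤ 1 - u := exp_one_sub_inv_le (by linarith)

theorem one_sub_le_exp_mul_one_add {u v : ℝ} (hu : 0 ≤ u) (hv : 0 ≤ v) :
    1 - u ≤ Real.exp (-(u + v) + 2 * (u ^ 2 + u * v + v ^ 2)) * (1 + v) := by
  have hinv : v - v ^ 2 ≤ 1 - (1 + v)⁻¹ := by
    rw [le_sub_comm, inv_le_iff_one_le_mul₀ (by linarith)]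
    nlinarith [pow_nonneg hv 3]
  calc 1 - u ≤ Real.exp (-u) := Real.one_sub_le_exp_neg u
    _ ≤ Real.exp (-(u + v) + 2 * (u ^ 2 + u * v + v ^ 2)) * Real.exp (1 - (1 + v)⁻¹) := by
        rw [← Real.exp_add, Real.exp_le_exp]
        nlinarith [mul_nonneg hu hv, sq_nonneg u, sq_nonneg v]
    _ ≤ _ := by
        gcongr
        exact exp_one_sub_inv_le (by linarith)

theorem binomProb_central_mul_exp_le {m j : ℕ} (hm : 0 < m) (hj : 2 * j ≤ m) :
    binomProb (2 * m) m * Real.exp (-(j : ℝ) ^ 2 / m - 2 * (j ^ 3 / m ^ 2)) ≤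
      binomProb (2 * m) (m + j) := by
  induction j with
  | zero => simp
  | succ j ih =>
    have hu : (j : ℝ) / m ≤ 1 / 2 := by
      rw [div_le_div_iff₀ (by positivity) two_pos]
      exact_mod_cast (by lia : j * 2 ≤ 1 * m)
    have hsplit : -((j + 1 : ℕ) : ℝ) ^ 2 / m - 2 * ((j + 1 : ℕ) ^ 3 / m ^ 2) =
        -(j : ℝ) ^ 2 / m - 2 * (j ^ 3 / m ^ 2) + (-(j / m + (j + 1) / m) -
          2 * ((j / m) ^ 2 + j / m * ((j + 1) / m) + ((j + 1) / m) ^ 2)) := by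
      push_cast; field_simp; ring
    rw [← mul_le_mul_iff_left₀ (show (0 : ℝ) < 1 + (j + 1) / m by positivity),
      binomProb_succ_mul hm (by lia), hsplit, Real.exp_add, ← mul_assoc, mul_assoc _ _ (1 + _)]
    exact mul_le_mul (ih (by lia))
      (exp_mul_one_add_le_one_sub (by positivity) hu (by positivity)) (by positivity)
      (binomProb_nonneg _ _)

theorem binomProb_le_central_mul_exp {m j : ℕ} (hm : 0 < m) (hj : j ≤ m) :
    binomProb (2 * m) (m + j) ≤
      binomProb (2 * m) m * Real.exp (-(j : ℝ) ^ 2 / m + 2 * (j ^ 3 / m ^ 2)) := by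
  induction j with
  | zero => simp
  | succ j ih =>
    have hu : (0 : ℝ) ≤ 1 - j / m := by
      rw [sub_nonneg, div_le_one₀ (by positivity)]
      exact_mod_cast (by lia : j ≤ m)
    have hB := binomProb_nonneg (2 * m) m
    have hsplit : -((j + 1 : ℕ) : ℝ) ^ 2 / m + 2 * ((j + 1 : ℕ) ^ 3 / m ^ 2) =
        -(j : ℝ) ^ 2 / m + 2 * (j ^ 3 / m ^ 2) + (-(j / m + (j + 1) / m) +
          2 * ((j / m) ^ 2 + j / m * ((j + 1) / m) + ((j + 1) / m) ^ 2)) := by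
      push_cast; field_simp; ring
    rw [← mul_le_mul_iff_left₀ (show (0 : ℝ) < 1 + (j + 1) / m by positivity),
      binomProb_succ_mul hm (by lia), hsplit, Real.exp_add, ← mul_assoc, mul_assoc _ _ (1 + _)]
    exact mul_le_mul (ih (by lia)) (one_sub_le_exp_mul_one_add (by positivity) (by positivity))
      hu (by positivity)

theorem gaussianProfile_nonneg (m : ℕ) (t : ℝ) : 0 ≤ gaussianProfile m t := by
  unfold gaussianProfile; positivity

theorem gaussianProfile_le (m : ℕ) (t : ℝ) : gaussianProfile m t ≤ 1 / √m := by
  rcases m.eq_zero_or_pos with rfl | hm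
  · simp [gaussianProfile]
  · rw [gaussianProfile]
    gcongr
    · exact Real.exp_le_one_iff.2 (div_nonpos_of_nonpos_of_nonneg (by nlinarith) (by positivity))
    · exact le_mul_of_one_le_left (by positivity) (by linarith [Real.pi_gt_three])

theorem exp_mul_gaussianProfile_le_binomProb {m j : ℕ} (hm : 0 < m) (hj : 2 * j ≤ m) :
    Real.exp (-(2 * ((j : ℝ) ^ 3 / m ^ 2) + 1 / m)) * gaussianProfile m j ≤
      binomProb (2 * m) (m + j) := by
  refine le_trans ?_ (binomProb_central_mul_exp_le hm hj)
  rw [gaussianProfile, mul_div_assoc', div_le_iff₀ (by positivity), ← Real.exp_add,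
    mul_right_comm]
  calc _ = Real.exp (-(1 / m)) * Real.exp (-(j : ℝ) ^ 2 / m - 2 * (j ^ 3 / m ^ 2)) := by
        rw [← Real.exp_add]; ring_nf
    _ ≤ _ := by
        gcongr
        exact exp_neg_inv_le_binomProb_central_mul_sqrt hm

theorem binomProb_le_exp_mul_gaussianProfile {m j : ℕ} (hm : 0 < m) (hj : j ≤ m) :
    binomProb (2 * m) (m + j) ≤ Real.exp (2 * ((j : ℝ) ^ 3 / m ^ 2)) * gaussianProfile m j := by
  refine (binomProb_le_central_mul_exp hm hj).trans ?_
  rw [gaussianProfile, mul_div_assoc' (Real.exp _), le_div_iff₀ (by positivity), ← Real.exp_add,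
    mul_right_comm, add_comm (2 * _)]
  exact mul_le_of_le_one_left (Real.exp_nonneg _) (binomProb_central_mul_sqrt_le_one m)

theorem binomProb_even_le {m : ℕ} (hm : 0 < m) (j : ℕ) : binomProb (2 * m) j ≤ 1 / √m := by
  refine (binomProb_le_middle _ _).trans ?_
  rw [Nat.mul_div_cancel_left m two_pos]
  have hcentral := binomProb_le_exp_mul_gaussianProfile hm (Nat.zero_le m)
  norm_num at hcentral
  exact hcentral.trans (gaussianProfile_le m 0)

theorem two_mul_le_of_le_mul_sqrt {A : ℝ} {m j : ℕ} (hmA : 2 * A ≤ √m) (hj : j ≤ A * √m) :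
    2 * j ≤ m := by
  have h : (2 * j : ℝ) ≤ m := by
    nlinarith [Real.mul_self_sqrt m.cast_nonneg, Real.sqrt_nonneg (m : ℝ)]
  exact_mod_cast h

theorem cube_div_sq_le {A : ℝ} {m j : ℕ} (hm : 0 < m) (hj : j ≤ A * √m) :
    (j : ℝ) ^ 3 / m ^ 2 ≤ A ^ 3 / √m := by
  rw [div_le_div_iff₀ (by positivity) (by positivity)]
  calc (j : ℝ) ^ 3 * √m ≤ (A * √m) ^ 3 * √m := by gcongr
    _ = A ^ 3 * (√m ^ 2) ^ 2 := by ring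
    _ = A ^ 3 * m ^ 2 := by rw [Real.sq_sqrt m.cast_nonneg]

section Window

-- The assumption `2 * A ^ 3 + 1 ≤ √m` makes the relative error of the local limit at most `1` for
-- all deviations `j ≤ A * √m`.
variable {A : ℝ} {m j : ℕ}

theorem relative_error_le (hm : 0 < m) (hj : j ≤ A * √m) :
    2 * ((j : ℝ) ^ 3 / m ^ 2) + 1 / m ≤ (2 * A ^ 3 + 1) / √m := by
  have hm1 : (1 : ℝ) ≤ m := by exact_mod_cast hm
  have hsqrt : 1 / (m : ℝ) ≤ 1 / √m :=
    one_div_le_one_div_of_le (by positivity) (Real.sqrt_le_self_iff.2 (Or.inr hm1))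
  have h := cube_div_sq_le hm hj
  rw [add_div, mul_div_assoc]
  linarith

theorem abs_binomProb_sub_gaussianProfile_le (hA : 1 ≤ A) (hmA : 2 * A ^ 3 + 1 ≤ √m)
    (hj : j ≤ A * √m) :
    |binomProb (2 * m) (m + j) - gaussianProfile m j| ≤
      2 * ((2 * A ^ 3 + 1) / √m) * gaussianProfile m j := by
  have hA3 : A ≤ A ^ 3 := le_self_pow₀ hA three_ne_zero
  have hs : 0 < √(m : ℝ) := by linarith
  have hm : 0 < m := by exact_mod_cast Real.sqrt_pos.1 hs
  have h2j : 2 * j ≤ m := two_mul_le_of_le_mul_sqrt (by linarith) hj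
  have herr := relative_error_le hm hj
  have hlow := exp_mul_gaussianProfile_le_binomProb hm h2j
  have hupp := binomProb_le_exp_mul_gaussianProfile hm (show j ≤ m by lia)
  have hg := gaussianProfile_nonneg m j
  set ε := 2 * ((j : ℝ) ^ 3 / m ^ 2)
  have hε0 : 0 ≤ ε := by positivity
  have hm0 : 0 ≤ 1 / (m : ℝ) := by positivity
  have hε1 : ε ≤ 1 := by linarith [(div_le_one₀ hs).2 hmA]
  have hexp : Real.exp ε - 1 ≤ 2 * ε := by
    simpa only [abs_of_nonneg hε0] using
      (le_abs_self _).trans (Real.abs_exp_sub_one_le (abs_le.2 ⟨by linarith, hε1⟩))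
  have hexp' := Real.add_one_le_exp (-(ε + 1 / m))
  rw [abs_le]
  constructor <;> nlinarith

theorem exp_div_sqrt_le_binomProb_add (hA : 1 ≤ A) (hmA : 2 * A ^ 3 + 1 ≤ √m)
    (hj : j ≤ A * √m) :
    Real.exp (-(A ^ 2 + 1)) / √Real.pi / √m ≤ binomProb (2 * m) (m + j) := by
  have hA3 : A ≤ A ^ 3 := le_self_pow₀ hA three_ne_zero
  have hs : 0 < √(m : ℝ) := by linarith
  have hm : 0 < m := by exact_mod_cast Real.sqrt_pos.1 hs
  have h2j : 2 * j ≤ m := two_mul_le_of_le_mul_sqrt (by linarith) hj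
  have herr : 2 * ((j : ℝ) ^ 3 / m ^ 2) + 1 / m ≤ 1 :=
    (relative_error_le hm hj).trans ((div_le_one₀ hs).2 hmA)
  have hsq : (j : ℝ) ^ 2 / m ≤ A ^ 2 := by
    rw [div_le_iff₀ (by positivity), ← Real.sq_sqrt m.cast_nonneg, ← mul_pow]
    gcongr
  refine le_trans ?_ (exp_mul_gaussianProfile_le_binomProb hm h2j)
  rw [gaussianProfile, mul_div_assoc', ← Real.exp_add, Real.sqrt_mul Real.pi_pos.le, div_div]
  gcongr
  rw [neg_div]
  linarith

theorem integral_gaussianProfile (hm : 0 < m) (J : ℕ) :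
    ∫ t in (0 : ℝ)..J, gaussianProfile m t = normalCDF (J * √(2 / m)) - 1 / 2 := by
  have hpdf : ∀ t, gaussianProfile m t = √(2 / m) * gaussianPDFReal 0 1 (√(2 / m) * t) := by
    intro t
    rw [gaussianPDFReal_zero_one, mul_pow, Real.sq_sqrt (by positivity), gaussianProfile,
      Real.sqrt_div zero_le_two, Real.sqrt_mul zero_le_two, Real.sqrt_mul Real.pi_pos.le]
    field_simp
  have hsubst := intervalIntegral.smul_integral_comp_mul_left (a := 0) (b := (J : ℝ))
    (gaussianPDFReal 0 1) √(2 / m)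
  rw [mul_zero, mul_comm] at hsubst
  rw [← normalCDF_zero, normalCDF_sub_eq_integral, ← hsubst, smul_eq_mul,
    ← intervalIntegral.integral_const_mul]
  exact intervalIntegral.integral_congr fun t _ => hpdf t

theorem antitoneOn_gaussianProfile (m : ℕ) : AntitoneOn (gaussianProfile m) (Set.Ici 0) := by
  intro a ha b _ hab
  have ha0 : 0 ≤ a := ha
  simp only [gaussianProfile]
  gcongr

theorem abs_sum_gaussianProfile_sub_normalCDF_le (hm : 0 < m) (J : ℕ) :
    |∑ i ∈ Finset.range J, gaussianProfile m i - (normalCDF (J * √(2 / m)) - 1 / 2)| ≤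
      1 / √m := by
  have hanti : AntitoneOn (gaussianProfile m) (Set.Icc 0 (0 + (J : ℝ))) :=
    (antitoneOn_gaussianProfile m).mono Set.Icc_subset_Ici_self
  have hlow := hanti.integral_le_sum
  have hupp := hanti.sum_le_integral
  have hshift := (Finset.sum_range_succ (fun i : ℕ => gaussianProfile m i) J).symm.trans
    (Finset.sum_range_succ' _ J)
  simp only [zero_add, integral_gaussianProfile hm, Nat.cast_zero] at hlow hupp hshift
  rw [abs_le]
  constructor <;> linarith [gaussianProfile_nonneg m J, gaussianProfile_le m 0]

theorem abs_sum_binomProb_sub_normalCDF_le (hA : 1 ≤ A) (hmA : 2 * A ^ 3 + 1 ≤ √m)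
    (hj : j ≤ A * √m) :
    |∑ i ∈ Finset.range j, binomProb (2 * m) (m + i) - (normalCDF (j * √(2 / m)) - 1 / 2)| ≤
      (2 * A * (2 * A ^ 3 + 1) + 1) / √m := by
  have hs : 0 < √(m : ℝ) := by linarith [le_self_pow₀ hA three_ne_zero]
  have hm : 0 < m := by exact_mod_cast Real.sqrt_pos.1 hs
  have hterm : ∀ i ∈ Finset.range j, |binomProb (2 * m) (m + i) - gaussianProfile m i| ≤
      2 * ((2 * A ^ 3 + 1) / √m) * (1 / √m) := fun i hi => by
    have hij : (i : ℝ) ≤ j := by exact_mod_cast (Finset.mem_range.1 hi).le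
    refine (abs_binomProb_sub_gaussianProfile_le hA hmA (hij.trans hj)).trans ?_
    gcongr
    exact gaussianProfile_le m i
  have hsum : |∑ i ∈ Finset.range j, binomProb (2 * m) (m + i) -
      ∑ i ∈ Finset.range j, gaussianProfile m i| ≤ 2 * A * (2 * A ^ 3 + 1) / √m := by
    rw [← Finset.sum_sub_distrib]
    refine (Finset.abs_sum_le_sum_abs _ _).trans ((Finset.sum_le_sum hterm).trans ?_)
    rw [Finset.sum_const, Finset.card_range, nsmul_eq_mul]
    calc _ ≤ A * √m * (2 * ((2 * A ^ 3 + 1) / √m) * (1 / √m)) := by gcongr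
      _ = _ := by field_simp
  rw [add_div]
  exact (abs_sub_le _ _ _).trans (add_le_add hsum (abs_sum_gaussianProfile_sub_normalCDF_le hm j))

theorem binomTail_add_binomTail {k N : ℕ} (h : N ≤ k + 1) :
    binomTail k N + binomTail k (k + 1 - N) = 1 := by
  have hreflect : binomTail k (k + 1 - N) = ∑ j ∈ Finset.range N, binomProb k j := by
    rw [binomTail, ← Finset.sum_range_reflect, Finset.sum_Ico_eq_sum_range,
      show k + 1 - (k + 1 - N) = N by lia]
    refine Finset.sum_congr rfl fun j hj => ?_
    have hj' := Finset.mem_range.1 hj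
    rw [← binomProb_symm (show N - 1 - j ≤ k by lia)]
    congr 1
    lia
  rw [hreflect, binomTail, ← sum_binomProb k, add_comm]
  exact Finset.sum_range_add_sum_Ico _ h

theorem binomTail_eq_sum_add {k N J : ℕ} (h : N + J ≤ k + 1) :
    binomTail k N = ∑ i ∈ Finset.range J, binomProb k (N + i) + binomTail k (N + J) := by
  rw [binomTail, binomTail, ← Finset.sum_Ico_consecutive _ (N.le_add_right J) h,
    Finset.sum_Ico_eq_sum_range, Nat.add_sub_cancel_left]

theorem binomTail_central (m : ℕ) :
    binomTail (2 * m) m = 1 / 2 + binomProb (2 * m) m / 2 := by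
  have hsymm := binomTail_add_binomTail (show m ≤ 2 * m + 1 by lia)
  have hsplit := binomTail_eq_sum_add (show m + 1 ≤ 2 * m + 1 by lia)
  rw [show 2 * m + 1 - m = m + 1 by lia] at hsymm
  rw [Finset.sum_range_one, add_zero] at hsplit
  linarith

theorem abs_binomTail_add_sub_normalCDF_le (hA : 1 ≤ A) (hmA : 2 * A ^ 3 + 1 ≤ √m)
    (hj : j ≤ A * √m) :
    |binomTail (2 * m) (m + j) - normalCDF (-(j * √(2 / m)))| ≤
      (2 * A * (2 * A ^ 3 + 1) + 2) / √m := by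
  have hA3 : A ≤ A ^ 3 := le_self_pow₀ hA three_ne_zero
  have hs : 0 < √(m : ℝ) := by linarith
  have hm : 0 < m := by exact_mod_cast Real.sqrt_pos.1 hs
  have h2j : 2 * j ≤ m := two_mul_le_of_le_mul_sqrt (by linarith) hj
  have hsum := abs_le.1 (abs_sum_binomProb_sub_normalCDF_le hA hmA hj)
  have hsplit := binomTail_eq_sum_add (show m + j ≤ 2 * m + 1 by lia)
  have hcentral := binomTail_central m
  have hle := binomProb_even_le hm m
  have h0 := binomProb_nonneg (2 * m) m
  have hbound : (2 * A * (2 * A ^ 3 + 1) + 2) / √m =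
      (2 * A * (2 * A ^ 3 + 1) + 1) / √m + 1 / √m := by ring
  rw [normalCDF_neg, hbound, abs_le]
  constructor <;> linarith

theorem abs_binomTail_sub_sub_normalCDF_le (hA : 1 ≤ A) (hmA : 2 * A ^ 3 + 1 ≤ √m)
    (hj : j ≤ A * √m) :
    |binomTail (2 * m) (m - j) - normalCDF (j * √(2 / m))| ≤
      (2 * A * (2 * A ^ 3 + 1) + 3) / √m := by
  have hA3 : A ≤ A ^ 3 := le_self_pow₀ hA three_ne_zero
  have hs : 0 < √(m : ℝ) := by linarith
  have hm : 0 < m := by exact_mod_cast Real.sqrt_pos.1 hs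
  have h2j : 2 * j ≤ m := two_mul_le_of_le_mul_sqrt (by linarith) hj
  have htail := abs_le.1 (abs_binomTail_add_sub_normalCDF_le hA hmA hj)
  have hsymm := binomTail_add_binomTail (show m - j ≤ 2 * m + 1 by lia)
  have hsplit := binomTail_eq_sum_add (show m + j + 1 ≤ 2 * m + 1 by lia)
  rw [show 2 * m + 1 - (m - j) = m + j + 1 by lia] at hsymm
  rw [Finset.sum_range_one, add_zero] at hsplit
  rw [normalCDF_neg] at htail
  have hle := binomProb_even_le hm (m + j)
  have h0 := binomProb_nonneg (2 * m) (m + j)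
  have hbound : (2 * A * (2 * A ^ 3 + 1) + 3) / √m =
      (2 * A * (2 * A ^ 3 + 1) + 2) / √m + 1 / √m := by ring
  rw [hbound, abs_le]
  constructor <;> linarith

theorem abs_binomTail_sub_normalCDF_le (hA : 1 ≤ A) (hmA : 2 * A ^ 3 + 1 ≤ √m) {N : ℕ}
    (hN : |(m : ℝ) - N| ≤ A * √m) :
    |binomTail (2 * m) N - normalCDF ((m - N) * √(2 / m))| ≤
      (2 * A * (2 * A ^ 3 + 1) + 3) / √m := by
  rcases le_total m N with h | h
  · obtain ⟨j, rfl⟩ := Nat.exists_eq_add_of_le h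
    have hcast : (m : ℝ) - (m + j : ℕ) = -j := by push_cast; ring
    rw [hcast, abs_neg, Nat.abs_cast] at hN
    rw [hcast, neg_mul]
    refine (abs_binomTail_add_sub_normalCDF_le hA hmA hN).trans ?_
    gcongr
    norm_num
  · obtain ⟨j, rfl⟩ := Nat.exists_eq_add_of_le h
    have hcast : ((N + j : ℕ) : ℝ) - N = j := by push_cast; ring
    rw [hcast, Nat.abs_cast] at hN
    simpa only [hcast, Nat.add_sub_cancel] using abs_binomTail_sub_sub_normalCDF_le hA hmA hN

theorem exp_div_sqrt_le_binomProb (hA : 1 ≤ A) (hmA : 2 * A ^ 3 + 1 ≤ √m)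
    (hj : |(m : ℝ) - j| ≤ A * √m) :
    Real.exp (-(A ^ 2 + 1)) / √Real.pi / √m ≤ binomProb (2 * m) j := by
  rcases le_total m j with h | h
  · obtain ⟨i, rfl⟩ := Nat.exists_eq_add_of_le h
    refine exp_div_sqrt_le_binomProb_add hA hmA ?_
    simpa only [Nat.cast_add, sub_add_cancel_left, abs_neg, Nat.abs_cast] using hj
  · obtain ⟨i, rfl⟩ := Nat.exists_eq_add_of_le h
    have hi : (i : ℝ) ≤ A * √(j + i : ℕ) := by
      simpa only [Nat.cast_add, add_sub_cancel_left, Nat.abs_cast] using hj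
    have hreflect : binomProb (2 * (j + i)) (j + i + i) = binomProb (2 * (j + i)) j := by
      rw [← binomProb_symm (show j ≤ 2 * (j + i) by lia)]
      congr 1
      lia
    rw [← hreflect]
    exact exp_div_sqrt_le_binomProb_add hA hmA hi

end Window

theorem exists_abs_binomTail_ceil_sub_normalCDF_le (A : ℝ) :
    ∃ C : ℝ, ∀ᶠ m : ℕ in atTop, ∀ τ : ℝ, |(m - τ) * √(2 / m)| ≤ A →
      |binomTail (2 * m) ⌈τ⌉₊ - normalCDF ((m - τ) * √(2 / m))| ≤ C / √m := by
  set D := max A 0 + 1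
  have hD1 : 1 ≤ D := by linarith [le_max_right A 0]
  refine ⟨2 * D * (2 * D ^ 3 + 1) + 5, ?_⟩
  have hsqrt : Tendsto (fun m : ℕ => √(m : ℝ)) atTop atTop :=
    Real.tendsto_sqrt_atTop.comp tendsto_natCast_atTop_atTop
  filter_upwards [hsqrt.eventually_ge_atTop (2 * D ^ 3 + 1)] with m hmD τ hτ
  have hD3 : D ≤ D ^ 3 := le_self_pow₀ hD1 three_ne_zero
  have hs : 0 < √(m : ℝ) := by linarith
  have hss : √(m : ℝ) * √m = m := Real.mul_self_sqrt m.cast_nonneg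
  have hscale : √(2 / m : ℝ) = √2 / √m := Real.sqrt_div zero_le_two _
  have hdist : |m - τ| ≤ (D - 1) * √m := by
    rw [← div_le_iff₀ hs]
    refine le_trans ?_ (hτ.trans (by linarith [le_max_left A 0]))
    rw [abs_mul, abs_of_nonneg (Real.sqrt_nonneg _), hscale, mul_div_assoc']
    gcongr
    exact le_mul_of_one_le_right (abs_nonneg _) (Real.one_le_sqrt.2 one_le_two)
  have hτ0 : 0 ≤ τ := by nlinarith [(abs_le.1 hdist).2]
  have hceil : |(⌈τ⌉₊ : ℝ) - τ| ≤ 1 := by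
    rw [abs_le]
    constructor <;> linarith [Nat.le_ceil τ, Nat.ceil_lt_add_one hτ0]
  have hN : |(m : ℝ) - ⌈τ⌉₊| ≤ D * √m := by
    have := abs_sub_le (m : ℝ) τ ⌈τ⌉₊
    rw [abs_sub_comm τ] at this
    linarith
  have hlip : |normalCDF ((m - ⌈τ⌉₊) * √(2 / m)) - normalCDF ((m - τ) * √(2 / m))| ≤ 2 / √m := by
    refine (abs_normalCDF_sub_le _ _).trans ?_
    rw [← sub_mul, sub_sub_sub_cancel_left, abs_mul, abs_sub_comm,
      abs_of_nonneg (Real.sqrt_nonneg (2 / (m : ℝ))), hscale, mul_div_assoc']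
    gcongr
    have hsqrt2 : √2 ≤ (2 : ℝ) := Real.sqrt_le_self_iff.2 (Or.inr one_le_two)
    nlinarith [Real.sqrt_nonneg (2 : ℝ)]
  have htail := abs_binomTail_sub_normalCDF_le hD1 hmD hN
  calc _ ≤ _ := abs_sub_le _ (normalCDF ((m - ⌈τ⌉₊) * √(2 / m))) _
    _ ≤ (2 * D * (2 * D ^ 3 + 1) + 3) / √m + 2 / √m := add_le_add htail hlip
    _ = _ := by ring

theorem exists_div_sqrt_le_binomProb (A : ℝ) :
    ∃ c > 0, ∀ᶠ k : ℕ in atTop, ∀ j : ℕ, |(k : ℝ) / 2 - j| ≤ A * √k → c / √k ≤ binomProb k j := by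
  set D := 2 * max A 0 + 1
  have hD1 : 1 ≤ D := by linarith [le_max_right A 0]
  refine ⟨Real.exp (-(D ^ 2 + 1)) / √Real.pi / 2, by positivity, ?_⟩
  have hsqrt : Tendsto (fun k : ℕ => √((k / 2 : ℕ) : ℝ)) atTop atTop :=
    Real.tendsto_sqrt_atTop.comp
      (tendsto_natCast_atTop_atTop.comp (Nat.tendsto_div_const_atTop two_ne_zero))
  filter_upwards [hsqrt.eventually_ge_atTop (2 * D ^ 3 + 1)] with k hkD j hj
  obtain ⟨m, hm⟩ : ∃ m, k / 2 = m := ⟨_, rfl⟩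
  rw [hm] at hkD
  have hs1 : 1 ≤ √(m : ℝ) := by linarith [pow_nonneg (zero_le_one.trans hD1) 3]
  have hm1 : (1 : ℝ) ≤ m := Real.one_le_sqrt.1 hs1
  have hmk : (2 * m : ℝ) ≤ k := by exact_mod_cast (show 2 * m ≤ k by lia)
  have hkm : (k : ℝ) ≤ 2 * m + 1 := by exact_mod_cast (show k ≤ 2 * m + 1 by lia)
  have hsk : √(k : ℝ) ≤ 2 * √m := by
    rw [Real.sqrt_le_left (by positivity), mul_pow, Real.sq_sqrt (by linarith)]
    linarith
  have hdist : |(m : ℝ) - j| ≤ D * √m := by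
    have hA : A * √k ≤ max A 0 * (2 * √m) :=
      mul_le_mul (le_max_left _ _) hsk (Real.sqrt_nonneg _) (le_max_right _ _)
    have hj' := abs_le.1 (hj.trans hA)
    rw [abs_le]
    constructor <;> linarith
  have hloc := exp_div_sqrt_le_binomProb hD1 hkD hdist
  have hhalf : binomProb (2 * m) j / 2 ≤ binomProb k j := by
    rcases Nat.mod_two_eq_zero_or_one k with h | h
    · rw [show k = 2 * m by lia]
      exact half_le_self (binomProb_nonneg _ _)
    · rw [show k = 2 * m + 1 by lia]
      exact half_binomProb_le_succ _ _
  calc Real.exp (-(D ^ 2 + 1)) / √Real.pi / 2 / √k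
      ≤ Real.exp (-(D ^ 2 + 1)) / √Real.pi / 2 / √m := by
        gcongr
        exact hm ▸ k.div_le_self 2
    _ ≤ binomProb k j := by rw [div_right_comm]; linarith

/-! ### Binomial occupancy of a single cell -/

noncomputable section

/-- The probability that a binomial variable with parameters `n` and `x` is at most one. -/
def atMostOneProb (n : ℕ) (x : ℝ) : ℝ := (1 - x) ^ n + n * x * (1 - x) ^ (n - 1)

end

theorem atMostOneProb_nonneg {n : ℕ} {x : ℝ} (h0 : 0 ≤ x) (h1 : x ≤ 1) :
    0 ≤ atMostOneProb n x := by
  have : 0 ≤ 1 - x := sub_nonneg.2 h1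
  unfold atMostOneProb
  positivity

theorem one_sub_atMostOneProb_le {n : ℕ} {x : ℝ} (h0 : 0 ≤ x) (h1 : x ≤ 1) :
    1 - atMostOneProb n x ≤ (n * x) ^ 2 := by
  rcases n with _ | n
  · simp [atMostOneProb]
  have hbernoulli : ∀ N : ℕ, 1 - N * x ≤ (1 - x) ^ N := fun N => by
    simpa only [mul_neg, ← sub_eq_add_neg] using
      one_add_mul_le_pow (show (-2 : ℝ) ≤ -x by linarith) N
  have hsecond : ((n + 1 : ℕ) : ℝ) * x * (1 - n * x) ≤ ((n + 1 : ℕ) : ℝ) * x * (1 - x) ^ n := by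
    gcongr
    exact hbernoulli n
  have hfirst := hbernoulli (n + 1)
  rw [atMostOneProb, Nat.add_sub_cancel]
  push_cast at *
  nlinarith [mul_nonneg n.cast_nonneg (mul_nonneg h0 h0), mul_nonneg h0 h0]

theorem one_sub_pow_le_exp_neg {x : ℝ} (h1 : x ≤ 1) (n : ℕ) :
    (1 - x) ^ n ≤ Real.exp (-(n * x)) :=
  calc (1 - x) ^ n ≤ Real.exp (-x) ^ n :=
        pow_le_pow_left₀ (sub_nonneg.2 h1) (Real.one_sub_le_exp_neg x) n
    _ = _ := by rw [← Real.exp_nat_mul, mul_neg]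

theorem atMostOneProb_le_div {n : ℕ} (hn : 2 ≤ n) {x : ℝ} (h0 : 0 < x) (h1 : x ≤ 1) :
    atMostOneProb n x ≤ 9 / (n * x) := by
  have hn2 : (2 : ℝ) ≤ n := by exact_mod_cast hn
  have hy0 : 0 < (n : ℝ) * x := by positivity
  have hfirst : (1 - x) ^ n ≤ 1 / (n * x) := by
    refine (one_sub_pow_le_exp_neg h1 n).trans ?_
    rw [Real.exp_neg, one_div]
    exact inv_anti₀ hy0 (by linarith [Real.add_one_le_exp (n * x)])
  have hpow : (1 - x) ^ (n - 1) ≤ 8 / (n * x) ^ 2 := by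
    refine (one_sub_pow_le_exp_neg h1 (n - 1)).trans ?_
    have hhalf : (n : ℝ) * x / 2 ≤ (n - 1 : ℕ) * x := by
      rw [Nat.cast_pred (by lia)]
      nlinarith
    rw [Real.exp_neg, inv_le_comm₀ (Real.exp_pos _) (by positivity), inv_div]
    refine le_trans ?_ (Real.exp_le_exp.2 hhalf)
    nlinarith [Real.quadratic_le_exp_of_nonneg (show 0 ≤ (n : ℝ) * x / 2 by positivity)]
  calc atMostOneProb n x ≤ 1 / (n * x) + n * x * (8 / (n * x) ^ 2) := by
        unfold atMostOneProb
        gcongr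
    _ = 9 / (n * x) := by field_simp; norm_num

theorem hasDerivAt_atMostOneProb (N : ℕ) (t : ℝ) :
    HasDerivAt (atMostOneProb (N + 2)) (-((N + 2) * (N + 1) * t * (1 - t) ^ N)) t := by
  have hsub : HasDerivAt (fun t : ℝ => 1 - t) (-1) t := (hasDerivAt_id t).const_sub 1
  have hsum := (hsub.fun_pow (N + 2)).fun_add
    (((hasDerivAt_id t).const_mul ((N + 2 : ℕ) : ℝ)).fun_mul (hsub.fun_pow (N + 1)))
  refine hsum.congr_deriv ?_
  simp only [id, show N + 2 - 1 = N + 1 by lia, Nat.add_sub_cancel]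
  push_cast
  ring

theorem le_atMostOneProb_sub {n : ℕ} (hn : 2 ≤ n) {a b : ℝ} (h0 : 0 ≤ a) (hab : a ≤ b)
    (h1 : b ≤ 1) :
    n * (n - 1) * a * (1 - b) ^ (n - 2) * (b - a) ≤ atMostOneProb n a - atMostOneProb n b := by
  obtain ⟨N, rfl⟩ := Nat.exists_eq_add_of_le' hn
  have hderiv : ∀ t, HasDerivAt (fun t => -atMostOneProb (N + 2) t)
      ((N + 2) * (N + 1) * t * (1 - t) ^ N) t := fun t =>
    (hasDerivAt_atMostOneProb N t).fun_neg.congr_deriv (neg_neg _)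
  have hle : ∀ t ∈ interior (Set.Icc a b), (N + 2) * (N + 1) * a * (1 - b) ^ N ≤
      deriv (fun t => -atMostOneProb (N + 2) t) t := by
    intro t ht
    rw [interior_Icc] at ht
    have hpow : (1 - b) ^ N ≤ (1 - t) ^ N :=
      pow_le_pow_left₀ (sub_nonneg.2 h1) (by linarith [ht.2]) N
    have : 0 ≤ (1 - b) ^ N := pow_nonneg (sub_nonneg.2 h1) N
    have hat := ht.1.le
    have ht0 : 0 ≤ t := h0.trans hat
    rw [(hderiv t).deriv]
    gcongr
  have hmean := (convex_Icc a b).mul_sub_le_image_sub_of_le_deriv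
    (fun t _ => (hderiv t).continuousAt.continuousWithinAt)
    (fun t _ => (hderiv t).differentiableAt.differentiableWithinAt) hle
    a (Set.left_mem_Icc.2 hab) b (Set.right_mem_Icc.2 hab) hab
  have hcast : ((N + 2 : ℕ) : ℝ) * ((N + 2 : ℕ) - 1) = (N + 2) * (N + 1) := by
    push_cast
    ring
  rw [hcast, Nat.add_sub_cancel]
  linarith

theorem atMostOneProb_le_atMostOneProb {n : ℕ} (hn : 2 ≤ n) {a b : ℝ} (h0 : 0 ≤ a) (hab : a ≤ b)
    (h1 : b ≤ 1) : atMostOneProb n b ≤ atMostOneProb n a := by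
  have hn2 : (2 : ℝ) ≤ n := by exact_mod_cast hn
  have hn1 : (0 : ℝ) ≤ n - 1 := by linarith
  have : 0 ≤ 1 - b := sub_nonneg.2 h1
  have : 0 ≤ b - a := sub_nonneg.2 hab
  exact sub_nonneg.1 ((by positivity : (0 : ℝ) ≤ _).trans (le_atMostOneProb_sub hn h0 hab h1))

theorem atMostOneProb_le_one {n : ℕ} (hn : 2 ≤ n) {x : ℝ} (h0 : 0 ≤ x) (h1 : x ≤ 1) :
    atMostOneProb n x ≤ 1 := by
  simpa [atMostOneProb] using atMostOneProb_le_atMostOneProb hn le_rfl h0 h1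

theorem exp_neg_two_mul_le_one_sub {x : ℝ} (h0 : 0 ≤ x) (h : x ≤ 1 / 2) :
    Real.exp (-(2 * x)) ≤ 1 - x := by
  refine le_trans (Real.exp_le_exp.2 ?_) (exp_one_sub_inv_le (show 0 < 1 - x by linarith))
  rw [le_sub_comm, inv_le_iff_one_le_mul₀ (by linarith)]
  nlinarith

theorem le_atMostOneProb_mul_sub {n : ℕ} (hn : 2 ≤ n) {p x : ℝ} (hp0 : 0 ≤ p) (hp1 : p ≤ 1)
    (hx0 : 0 ≤ x) (hx : x ≤ 1 / 2) :
    p * (1 - p) * ((n * x) ^ 2 / 2 * Real.exp (-(2 * (n * x)))) ≤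
      atMostOneProb n (p * x) - atMostOneProb n x := by
  have hn2 : (2 : ℝ) ≤ n := by exact_mod_cast hn
  have hexp : Real.exp (-(2 * (n * x))) ≤ (1 - x) ^ (n - 2) :=
    calc Real.exp (-(2 * (n * x))) = Real.exp (-(2 * x)) ^ n := by
          rw [← Real.exp_nat_mul]
          ring_nf
      _ ≤ (1 - x) ^ n :=
          pow_le_pow_left₀ (Real.exp_nonneg _) (exp_neg_two_mul_le_one_sub hx0 hx) n
      _ ≤ (1 - x) ^ (n - 2) := pow_le_pow_of_le_one (by linarith) (by linarith) (n.sub_le 2)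
  have hsq : ((n : ℝ) * x) ^ 2 / 2 ≤ n * (n - 1) * x ^ 2 := by
    nlinarith [mul_nonneg (mul_nonneg n.cast_nonneg (sub_nonneg.2 hn2)) (sq_nonneg x)]
  have : 0 ≤ 1 - p := sub_nonneg.2 hp1
  have hsq0 : 0 ≤ (n : ℝ) * (n - 1) * x ^ 2 := le_trans (by positivity) hsq
  have hpx : p * x ≤ x := mul_le_of_le_one_left hx0 hp1
  calc _ ≤ p * (1 - p) * ((n : ℝ) * (n - 1) * x ^ 2 * (1 - x) ^ (n - 2)) := by gcongr
    _ = n * (n - 1) * (p * x) * (1 - x) ^ (n - 2) * (x - p * x) := by ring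
    _ ≤ _ := le_atMostOneProb_sub hn (by positivity) hpx (by linarith)

/-! ### Averages over the cells of a level -/

noncomputable section

/-- The average of `f` over the probabilities of the `2 ^ k` words of length `k`, when the two
letters have probabilities `p` and `q`. -/
def cellAverage (p q : ℝ) (k : ℕ) (f : ℝ → ℝ) : ℝ :=
  (∑ r : Fin k → Bool, f (∏ i, if r i then p else q)) / 2 ^ k

/-- The mean proportion of filled nodes at level `k` of a trie built from `n` strings. -/
def meanFill (p q : ℝ) (n k : ℕ) : ℝ := cellAverage p q k fun x => 1 - atMostOneProb n x

end

theorem cellAverage_succ (p q : ℝ) (k : ℕ) (f : ℝ → ℝ) :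
    cellAverage p q (k + 1) f = cellAverage p q k fun x => (f (p * x) + f (q * x)) / 2 := by
  have hcons := (Fin.consEquiv fun _ : Fin (k + 1) => Bool).sum_comp
    fun r => f (∏ i, if r i then p else q)
  simp only [Fintype.sum_prod_type, Fintype.sum_bool, Fin.consEquiv_apply, Fin.prod_univ_succ,
    Fin.cons_zero, Fin.cons_succ, if_true, Bool.false_eq_true, if_false] at hcons
  simp only [cellAverage, Fin.prod_univ_succ]
  rw [← hcons, ← Finset.sum_add_distrib, ← Finset.sum_div, pow_succ', div_div]

theorem cellAverage_comm (p q : ℝ) (k : ℕ) (f : ℝ → ℝ) :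
    cellAverage p q k f = cellAverage q p k f := by
  rw [cellAverage, ← (Equiv.arrowCongr (.refl _) Equiv.boolNot).sum_comp, cellAverage]
  congr! 4 with r _ i
  cases h : r i <;> simp [h]

theorem prod_ite_eq_pow_mul_pow {ι R : Type*} [Fintype ι] [CommMonoid R] (r : ι → Prop)
    [DecidablePred r] (p q : R) :
    ∏ i, (if r i then p else q) =
      p ^ (Finset.univ.filter r).card * q ^ (Fintype.card ι - (Finset.univ.filter r).card) := by
  classical
  rw [Finset.prod_ite, Finset.prod_const, Finset.prod_const, Finset.filter_not,
    ← Finset.compl_eq_univ_sdiff, Finset.card_compl]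

theorem cellAverage_eq_sum_range (p q : ℝ) (k : ℕ) (f : ℝ → ℝ) :
    cellAverage p q k f =
      ∑ j ∈ Finset.range (k + 1), binomProb k j * f (p ^ j * q ^ (k - j)) := by
  have hsubsets : ∑ r : Fin k → Bool, f (∏ i, if r i then p else q) =
      ∑ s ∈ (Finset.univ : Finset (Fin k)).powerset, f (p ^ s.card * q ^ (k - s.card)) :=
    Finset.sum_nbij' (fun r => Finset.univ.filter (r · = true)) (fun s i => decide (i ∈ s))
      (by simp) (by simp) (by simp) (by simp) fun r _ => by
        rw [prod_ite_eq_pow_mul_pow, Fintype.card_fin]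
  rw [cellAverage, hsubsets, Finset.sum_powerset_apply_card (fun j => f (p ^ j * q ^ (k - j))),
    Finset.card_univ, Fintype.card_fin, Finset.sum_div]
  refine Finset.sum_congr rfl fun j _ => ?_
  rw [nsmul_eq_mul, binomProb, div_mul_eq_mul_div]

theorem cellAverage_sub (p q : ℝ) (k : ℕ) (f g : ℝ → ℝ) :
    cellAverage p q k f - cellAverage p q k g = cellAverage p q k fun x => f x - g x := by
  simp only [cellAverage, Finset.sum_sub_distrib, sub_div]

theorem meanFill_comm (p q : ℝ) (n k : ℕ) : meanFill p q n k = meanFill q p n k :=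
  cellAverage_comm _ _ _ _

theorem cellProb_le_one {p q : ℝ} (hp : 0 ≤ p) (hq : 0 ≤ q) (hpq : p + q = 1) (i j : ℕ) :
    p ^ i * q ^ j ≤ 1 :=
  mul_le_one₀ (pow_le_one₀ hp (by linarith)) (by positivity) (pow_le_one₀ hq (by linarith))

/-- The mean decrease of the fill indicator from a cell of probability `x` to its two subcells. -/
noncomputable def cellDrop (p q : ℝ) (n : ℕ) (x : ℝ) : ℝ :=
  (atMostOneProb n (p * x) - atMostOneProb n x) / 2 +
    (atMostOneProb n (q * x) - atMostOneProb n x) / 2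

theorem meanFill_sub_succ (p q : ℝ) (n k : ℕ) :
    meanFill p q n k - meanFill p q n (k + 1) = cellAverage p q k (cellDrop p q n) := by
  rw [meanFill, meanFill, cellAverage_succ, cellAverage_sub]
  congr 1 with x
  rw [cellDrop]
  ring

section Drop

variable {p q : ℝ} {n : ℕ}

theorem half_sub_le_cellDrop (hq : 0 ≤ q) (hq1 : q ≤ 1) (hn : 2 ≤ n) {x : ℝ} (h0 : 0 ≤ x)
    (h1 : x ≤ 1) : (atMostOneProb n (p * x) - atMostOneProb n x) / 2 ≤ cellDrop p q n x := by
  have hqx := atMostOneProb_le_atMostOneProb hn (mul_nonneg hq h0)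
    (mul_le_of_le_one_left h0 hq1) h1
  rw [cellDrop]
  linarith

theorem cellDrop_nonneg (hp : 0 ≤ p) (hq : 0 ≤ q) (hpq : p + q = 1) (hn : 2 ≤ n) {x : ℝ}
    (h0 : 0 ≤ x) (h1 : x ≤ 1) : 0 ≤ cellDrop p q n x := by
  have hpx := atMostOneProb_le_atMostOneProb hn (mul_nonneg hp h0)
    (mul_le_of_le_one_left h0 (by linarith)) h1
  linarith [half_sub_le_cellDrop (p := p) hq (by linarith) hn h0 h1]

theorem binomProb_mul_cellDrop_le (hp : 0 ≤ p) (hq : 0 ≤ q) (hpq : p + q = 1) (hn : 2 ≤ n)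
    {k j : ℕ} (hj : j ≤ k) :
    binomProb k j * cellDrop p q n (p ^ j * q ^ (k - j)) ≤
      meanFill p q n k - meanFill p q n (k + 1) := by
  rw [meanFill_sub_succ, cellAverage_eq_sum_range]
  exact Finset.single_le_sum (f := fun j => binomProb k j * cellDrop p q n (p ^ j * q ^ (k - j)))
    (fun i _ => mul_nonneg (binomProb_nonneg k i)
      (cellDrop_nonneg hp hq hpq hn (by positivity) (cellProb_le_one hp hq hpq i (k - i))))
    (Finset.mem_range_succ_iff.2 hj)

theorem antitone_meanFill (hp : 0 ≤ p) (hq : 0 ≤ q) (hpq : p + q = 1) (hn : 2 ≤ n) :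
    Antitone (meanFill p q n) :=
  antitone_nat_of_succ_le fun k => sub_nonneg.1 <| by
    have hterm := cellDrop_nonneg hp hq hpq hn (x := p ^ 0 * q ^ k) (by positivity)
      (cellProb_le_one hp hq hpq 0 k)
    exact (mul_nonneg (binomProb_nonneg k 0) hterm).trans
      (binomProb_mul_cellDrop_le hp hq hpq hn k.zero_le)

end Drop

/-! ### Normal approximation of the mean fill proportion -/

theorem abs_one_sub_atMostOneProb_sub_ite_le {n : ℕ} (hn : 2 ≤ n) {x t : ℝ} (h0 : 0 < x)
    (h1 : x ≤ 1) (ht : n * x = Real.exp t) :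
    |1 - atMostOneProb n x - (if 0 ≤ t then 1 else 0)| ≤ 9 * Real.exp (-|t|) := by
  split_ifs with h
  · have hle := atMostOneProb_le_div hn h0 h1
    rw [ht, div_eq_mul_inv, ← Real.exp_neg] at hle
    rwa [sub_sub_cancel_left, abs_neg, abs_of_nonneg (atMostOneProb_nonneg h0.le h1),
      abs_of_nonneg h]
  · have hle := one_sub_atMostOneProb_le (n := n) h0.le h1
    have hexp1 : Real.exp t ≤ 1 := Real.exp_le_one_iff.2 (not_le.1 h).le
    rw [ht] at hle
    rw [sub_zero, abs_of_nonneg (sub_nonneg.2 (atMostOneProb_le_one hn h0.le h1)),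
      abs_of_neg (not_le.1 h), neg_neg]
    nlinarith [Real.exp_pos t]

theorem sum_range_pow_le {r : ℝ} (h0 : 0 ≤ r) (h1 : r < 1) (K : ℕ) :
    ∑ i ∈ Finset.range K, r ^ i ≤ (1 - r)⁻¹ :=
  tsum_geometric_of_lt_one h0 h1 ▸
    (summable_geometric_of_lt_one h0 h1).sum_le_tsum _ fun i _ => pow_nonneg h0 i

theorem sum_exp_neg_mul_abs_sub_le {lam : ℝ} (hlam : 0 < lam) (τ : ℝ) (K : ℕ) :
    ∑ j ∈ Finset.range K, Real.exp (-(lam * |(j : ℝ) - τ|)) ≤ 2 * (1 - Real.exp (-lam))⁻¹ := by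
  set r := Real.exp (-lam) with hr
  have hr1 : r < 1 := Real.exp_lt_one_iff.2 (neg_lt_zero.2 hlam)
  have hpow : ∀ (i : ℕ) (x : ℝ), i ≤ |x| → Real.exp (-(lam * |x|)) ≤ r ^ i := fun i x hx => by
    rw [hr, ← Real.exp_nat_mul]
    exact Real.exp_le_exp.2 (by nlinarith)
  have hbelow : ∑ j ∈ Finset.range ⌈τ⌉₊, Real.exp (-(lam * |(j : ℝ) - τ|)) ≤
      ∑ j ∈ Finset.range ⌈τ⌉₊, r ^ (⌈τ⌉₊ - 1 - j) := by
    refine Finset.sum_le_sum fun j hj => hpow _ _ ?_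
    have hjN := Finset.mem_range.1 hj
    have hjτ : (j : ℝ) < τ := Nat.lt_ceil.1 hjN
    have hN := Nat.ceil_lt_add_one (j.cast_nonneg.trans hjτ.le)
    rw [abs_of_neg (sub_neg.2 hjτ), Nat.cast_sub (by lia), Nat.cast_pred (by lia)]
    linarith
  have habove : ∑ i ∈ Finset.range K, Real.exp (-(lam * |((⌈τ⌉₊ + i : ℕ) : ℝ) - τ|)) ≤
      ∑ i ∈ Finset.range K, r ^ i := by
    refine Finset.sum_le_sum fun i _ => hpow _ _ (le_trans ?_ (le_abs_self _))
    push_cast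
    linarith [Nat.le_ceil τ]
  rw [Finset.sum_range_reflect] at hbelow
  calc _ ≤ ∑ j ∈ Finset.range (⌈τ⌉₊ + K), Real.exp (-(lam * |(j : ℝ) - τ|)) :=
        Finset.sum_le_sum_of_subset_of_nonneg (Finset.range_mono (by lia))
          fun _ _ _ => Real.exp_nonneg _
    _ ≤ (1 - r)⁻¹ + (1 - r)⁻¹ := by
        rw [Finset.sum_range_add]
        exact add_le_add (hbelow.trans (sum_range_pow_le (Real.exp_nonneg _) hr1 _))
          (habove.trans (sum_range_pow_le (Real.exp_nonneg _) hr1 _))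
    _ = _ := (two_mul _).symm

theorem binomTail_ceil (k : ℕ) (τ : ℝ) :
    binomTail k ⌈τ⌉₊ =
      ∑ j ∈ Finset.range (k + 1), binomProb k j * (if τ ≤ j then 1 else 0) := by
  simp only [binomTail, mul_ite, mul_one, mul_zero, ← Finset.sum_filter]
  refine Finset.sum_congr ?_ fun _ _ => rfl
  ext j
  simp only [Finset.mem_Ico, Finset.mem_filter, Finset.mem_range, Nat.ceil_le, and_comm]

noncomputable section

/-- The (real) number of ones at which the probability of a word of length `k` equals `1 / n`. -/
def cellThreshold (p q : ℝ) (n k : ℕ) : ℝ :=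
  (-(k * Real.log q) - Real.log n) / Real.log (p / q)

/-- The rate at which the logarithm of a typical cell probability decreases with the level. -/
def levelRate (p q : ℝ) : ℝ := Real.log (1 / √(p * q))

end

theorem levelRate_comm (p q : ℝ) : levelRate p q = levelRate q p := by
  rw [levelRate, levelRate, mul_comm]

theorem levelRate_eq {p q : ℝ} (hp : 0 < p) (hq : 0 < q) :
    levelRate p q = -(Real.log p + Real.log q) / 2 := by
  rw [levelRate, one_div, Real.log_inv, Real.log_sqrt (by positivity), Real.log_mul hp.ne' hq.ne',
    neg_div]

theorem levelRate_pos {p q : ℝ} (hp : 0 < p) (hq : 0 < q) (hpq : p + q = 1) :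
    0 < levelRate p q := by
  rw [levelRate_eq hp hq]
  linarith [Real.log_neg hp (by linarith), Real.log_neg hq (by linarith)]

theorem log_div_pos {p q : ℝ} (hq : 0 < q) (hqp : q < p) : 0 < Real.log (p / q) :=
  Real.log_pos ((one_lt_div hq).2 hqp)

theorem two_div_sqrt_two_mul (m : ℕ) : 2 / √((2 * m : ℕ) : ℝ) = √(2 / m) := by
  rw [← Real.sqrt_sq zero_le_two, ← Real.sqrt_div (by positivity)]
  congr 1
  push_cast
  rw [sq, mul_div_mul_left _ _ two_ne_zero, Real.sqrt_mul_self zero_le_two]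

section Biased

variable {p q : ℝ} (hq : 0 < q) (hqp : q < p)
include hq hqp

theorem mul_cellProb_eq_exp {n : ℕ} (hn : n ≠ 0) {j k : ℕ} (hj : j ≤ k) :
    n * (p ^ j * q ^ (k - j)) =
      Real.exp (Real.log (p / q) * (j - cellThreshold p q n k)) := by
  have hp : 0 < p := hq.trans hqp
  have hlog : Real.log (p / q) * (j - cellThreshold p q n k) =
      Real.log n + (j * Real.log p + ((k - j : ℕ) : ℝ) * Real.log q) := by
    rw [cellThreshold, mul_sub, mul_div_cancel₀ _ (log_div_pos hq hqp).ne',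
      Real.log_div hp.ne' hq.ne', Nat.cast_sub hj]
    ring
  rw [hlog, Real.exp_add, Real.exp_add, Real.exp_log (by positivity), Real.exp_nat_mul,
    Real.exp_nat_mul, Real.exp_log hp, Real.exp_log hq]

theorem half_sub_cellThreshold (n k : ℕ) :
    k / 2 - cellThreshold p q n k = (Real.log n - k * levelRate p q) / Real.log (p / q) := by
  have hp : 0 < p := hq.trans hqp
  have hlam := (log_div_pos hq hqp).ne'
  rw [levelRate_eq hp hq, cellThreshold]
  field_simp
  rw [Real.log_div hp.ne' hq.ne']
  ring

theorem abs_meanFill_sub_binomTail_le (hpq : p + q = 1) {n m : ℕ} (hn : 2 ≤ n) (hm : 0 < m) :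
    |meanFill p q n (2 * m) - binomTail (2 * m) ⌈cellThreshold p q n (2 * m)⌉₊| ≤
      18 * (1 - Real.exp (-Real.log (p / q)))⁻¹ / √m := by
  have hp : 0 < p := hq.trans hqp
  have hlam := log_div_pos hq hqp
  set τ := cellThreshold p q n (2 * m)
  have hterm : ∀ j ∈ Finset.range (2 * m + 1),
      |binomProb (2 * m) j * (1 - atMostOneProb n (p ^ j * q ^ (2 * m - j))) -
        binomProb (2 * m) j * (if τ ≤ j then 1 else 0)| ≤
      1 / √m * (9 * Real.exp (-(Real.log (p / q) * |(j : ℝ) - τ|))) := by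
    intro j hj
    have hcell := mul_cellProb_eq_exp hq hqp (show n ≠ 0 by lia) (Finset.mem_range_succ_iff.1 hj)
    have hfill := abs_one_sub_atMostOneProb_sub_ite_le hn (by positivity)
      (cellProb_le_one hp.le hq.le hpq j (2 * m - j)) hcell
    simp only [mul_nonneg_iff_of_pos_left hlam, sub_nonneg, abs_mul, abs_of_pos hlam] at hfill
    rw [← mul_sub, abs_mul, abs_of_nonneg (binomProb_nonneg _ _)]
    exact mul_le_mul (binomProb_even_le hm j) hfill (abs_nonneg _) (by positivity)
  rw [meanFill, cellAverage_eq_sum_range, binomTail_ceil, ← Finset.sum_sub_distrib]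
  refine (Finset.abs_sum_le_sum_abs _ _).trans ((Finset.sum_le_sum hterm).trans ?_)
  rw [← Finset.mul_sum, ← Finset.mul_sum]
  calc _ ≤ 1 / √(m : ℝ) * (9 * (2 * (1 - Real.exp (-Real.log (p / q)))⁻¹)) := by
        gcongr
        exact sum_exp_neg_mul_abs_sub_le hlam τ (2 * m + 1)
    _ = _ := by ring

theorem exists_abs_meanFill_sub_normalCDF_le (hpq : p + q = 1) (A : ℝ) :
    ∃ C : ℝ, ∀ᶠ m : ℕ in atTop, ∀ n : ℕ, 2 ≤ n → ∀ z : ℝ,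
      z = (Real.log n - (2 * m : ℕ) * levelRate p q) / Real.log (p / q) * (2 / √(2 * m : ℕ)) →
      |z| ≤ A → |meanFill p q n (2 * m) - normalCDF z| ≤ C / √m := by
  obtain ⟨C, hC⟩ := exists_abs_binomTail_ceil_sub_normalCDF_le A
  refine ⟨18 * (1 - Real.exp (-Real.log (p / q)))⁻¹ + C, ?_⟩
  filter_upwards [hC, eventually_gt_atTop 0] with m hm hm0 n hn z hz hzA
  rw [← half_sub_cellThreshold hq hqp, two_div_sqrt_two_mul, Nat.cast_mul, Nat.cast_ofNat,
    mul_div_cancel_left₀ _ two_ne_zero] at hz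
  have htail := hm (cellThreshold p q n (2 * m)) (hz ▸ hzA)
  rw [← hz] at htail
  rw [add_div]
  exact (abs_sub_le _ _ _).trans
    (add_le_add (abs_meanFill_sub_binomTail_le hq hqp hpq hn hm0) htail)

theorem exists_le_cellDrop (hpq : p + q = 1) :
    ∃ b > 0, ∀ᶠ n : ℕ in atTop, ∀ x : ℝ, 1 ≤ n * x → n * x ≤ p / q → b ≤ cellDrop p q n x := by
  have hp : 0 < p := hq.trans hqp
  have hp1 : 0 < 1 - p := by linarith
  refine ⟨p * (1 - p) * (1 ^ 2 / 2 * Real.exp (-(2 * (p / q)))) / 2, by positivity, ?_⟩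
  filter_upwards [eventually_ge_atTop 2,
    tendsto_natCast_atTop_atTop.eventually_ge_atTop (2 * (p / q))] with n hn hnp x hx1 hx2
  have hn0 : (0 : ℝ) < n := by positivity
  have hx0 : 0 ≤ x := nonneg_of_mul_nonneg_right (zero_le_one.trans hx1) hn0
  have hx : x ≤ 1 / 2 := le_of_mul_le_mul_left (by linarith) hn0
  refine le_trans ?_ (half_sub_le_cellDrop hq.le (by linarith) hn hx0 (by linarith))
  refine (div_le_div_of_nonneg_right ?_ zero_le_two).trans (div_le_div_of_nonneg_right
    (le_atMostOneProb_mul_sub hn hp.le (by linarith) hx0 hx) zero_le_two)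
  gcongr

end Biased

/-! ### Standardized levels -/

noncomputable section

/-- The scale, relative to `√(log n)`, of the window of levels in which the mean fill proportion
falls from nearly one to nearly zero. -/
def levelSpread (p q : ℝ) : ℝ := |Real.log (p / q)| / (2 * levelRate p q ^ (3 / 2 : ℝ))

/-- The standardized level: `meanFill p q n k` is asymptotic to `normalCDF (levelScore p q n k)`. -/
def levelScore (p q : ℝ) (n k : ℕ) : ℝ :=
  (Real.logb (1 / √(p * q)) n - k) / (levelSpread p q * √(Real.log n))

end

theorem levelSpread_comm (p q : ℝ) : levelSpread p q = levelSpread q p := by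
  rw [levelSpread, levelSpread, levelRate_comm, ← inv_div q p, Real.log_inv, abs_neg]

theorem tendsto_sqrt_log_natCast_atTop : Tendsto (fun n : ℕ => √(Real.log n)) atTop atTop :=
  Real.tendsto_sqrt_atTop.comp (Real.tendsto_log_atTop.comp tendsto_natCast_atTop_atTop)

theorem abs_sqrt_sub_one_le {x : ℝ} (hx : 0 ≤ x) : |√x - 1| ≤ |x - 1| := by
  have hfactor : x - 1 = (√x - 1) * (√x + 1) := by linarith [Real.mul_self_sqrt hx]
  rw [hfactor, abs_mul, abs_of_nonneg (by positivity : 0 ≤ √x + 1)]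
  exact le_mul_of_one_le_right (abs_nonneg _) (by linarith [Real.sqrt_nonneg x])

theorem levelScore_sub (p q : ℝ) (n k l : ℕ) :
    levelScore p q n k - levelScore p q n l = (l - k) / (levelSpread p q * √(Real.log n)) := by
  rw [levelScore, levelScore, ← sub_div, sub_sub_sub_cancel_left]

theorem ceil_le_and_abs_half_sub_ceil_le {k : ℕ} {τ D : ℝ} (hD : 0 ≤ D) (hk : 2 * D + 2 ≤ √k)
    (h : |(k : ℝ) / 2 - τ| ≤ D * √k) :
    0 ≤ τ ∧ ⌈τ⌉₊ ≤ k ∧ |(k : ℝ) / 2 - ⌈τ⌉₊| ≤ (D + 1) * √k := by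
  have hsq : √k * √k = (k : ℝ) := Real.mul_self_sqrt k.cast_nonneg
  have hmul : (2 * D + 2) * √k ≤ √k * √k := by gcongr
  have hτ := abs_le.1 h
  have hτ0 : 0 ≤ τ := by linarith [Real.sqrt_nonneg k]
  refine ⟨hτ0, Nat.ceil_le.2 (by linarith [Real.sqrt_nonneg k]), abs_le.2 ⟨?_, ?_⟩⟩
  · linarith [Nat.ceil_lt_add_one hτ0]
  · linarith [Nat.le_ceil τ, Real.sqrt_nonneg k]

section Biased

variable {p q : ℝ} (hq : 0 < q) (hqp : q < p) (hpq : p + q = 1)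
include hq hqp hpq

theorem levelSpread_mul : levelSpread p q * (2 * (levelRate p q * √(levelRate p q))) =
    Real.log (p / q) := by
  have hL := levelRate_pos (hq.trans hqp) hq hpq
  rw [levelSpread, abs_of_pos (log_div_pos hq hqp), show (3 / 2 : ℝ) = 1 + 1 / 2 by norm_num,
    Real.rpow_add hL, Real.rpow_one, ← Real.sqrt_eq_rpow]
  field_simp

theorem levelSpread_pos : 0 < levelSpread p q := by
  have hL := levelRate_pos (hq.trans hqp) hq hpq
  refine pos_of_mul_pos_left ?_ (by positivity : 0 ≤ 2 * (levelRate p q * √(levelRate p q)))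
  rw [levelSpread_mul hq hqp hpq]
  exact log_div_pos hq hqp

theorem log_sub_mul_levelRate {n : ℕ} (hn : 2 ≤ n) (k : ℕ) :
    Real.log n - k * levelRate p q =
      levelRate p q * levelSpread p q * √(Real.log n) * levelScore p q n k := by
  have hL := levelRate_pos (hq.trans hqp) hq hpq
  have hc := levelSpread_pos hq hqp hpq
  have hlog : 0 < Real.log n := Real.log_pos (by exact_mod_cast hn)
  rw [levelScore, Real.logb, ← levelRate]
  field_simp

theorem eventually_levelRate_mul_mem_Icc (A : ℝ) :
    ∀ᶠ n : ℕ in atTop, ∀ k : ℕ, |levelScore p q n k| ≤ A →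
      k * levelRate p q ∈ Set.Icc (Real.log n / 2) (2 * Real.log n) := by
  have hL := levelRate_pos (hq.trans hqp) hq hpq
  have hc := levelSpread_pos hq hqp hpq
  filter_upwards [eventually_ge_atTop 2, tendsto_sqrt_log_natCast_atTop.eventually_ge_atTop
    (2 * (levelRate p q * levelSpread p q * A))] with n hn hs k hk
  have hlog : √(Real.log n) ^ 2 = Real.log n := Real.sq_sqrt (Real.log_natCast_nonneg n)
  have hdist : |Real.log n - k * levelRate p q| ≤ Real.log n / 2 := by
    rw [log_sub_mul_levelRate hq hqp hpq hn, abs_mul, abs_of_nonneg (by positivity)]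
    calc _ ≤ levelRate p q * levelSpread p q * √(Real.log n) * A := by gcongr
      _ = √(Real.log n) * (2 * (levelRate p q * levelSpread p q * A)) / 2 := by ring
      _ ≤ √(Real.log n) * √(Real.log n) / 2 := by gcongr
      _ = _ := by rw [← sq, hlog]
  have h := abs_le.1 hdist
  constructor <;> linarith [Real.log_natCast_nonneg n]

theorem eventually_forall_of_abs_levelScore_le {P : ℕ → Prop} (h : ∀ᶠ k in atTop, P k) (A : ℝ) :
    ∀ᶠ n : ℕ in atTop, ∀ k : ℕ, |levelScore p q n k| ≤ A → P k := by
  have hL := levelRate_pos (hq.trans hqp) hq hpq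
  obtain ⟨k₀, hk₀⟩ := eventually_atTop.1 h
  filter_upwards [eventually_levelRate_mul_mem_Icc hq hqp hpq A,
    (Real.tendsto_log_atTop.comp tendsto_natCast_atTop_atTop).eventually_ge_atTop
      (2 * (k₀ * levelRate p q))] with n hn hlog k hk
  refine hk₀ k ?_
  have hle : k₀ * levelRate p q ≤ k * levelRate p q := by
    have hlog' : 2 * (k₀ * levelRate p q) ≤ Real.log n := hlog
    linarith [(hn k hk).1]
  exact_mod_cast le_of_mul_le_mul_right hle hL

/-- `log n` and `k * levelRate p q` agree to first order, so that the standardization by `√(log n)`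
may be replaced by the standardization by the standard deviation `√k / 2`. -/
theorem exists_abs_mul_sqrt_sub_levelScore_le (A : ℝ) :
    ∃ D : ℝ, ∀ᶠ n : ℕ in atTop, ∀ k : ℕ, |levelScore p q n k| ≤ A →
      |(Real.log n - k * levelRate p q) / Real.log (p / q) * (2 / √k) - levelScore p q n k| ≤
        D / √(Real.log n) := by
  have hL := levelRate_pos (hq.trans hqp) hq hpq
  have hc := levelSpread_pos hq hqp hpq
  refine ⟨2 * (levelRate p q * levelSpread p q) * A ^ 2, ?_⟩
  filter_upwards [eventually_ge_atTop 2, eventually_levelRate_mul_mem_Icc hq hqp hpq A]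
    with n hn hwin k hk
  have hlog : 0 < Real.log n := Real.log_pos (by exact_mod_cast hn)
  have hsq : √(Real.log n) ^ 2 = Real.log n := Real.sq_sqrt hlog.le
  have hkL : 0 < k * levelRate p q := by linarith [(hwin k hk).1]
  have hk0 : (0 : ℝ) < k := pos_of_mul_pos_left hkL hL.le
  have hA0 : 0 ≤ A := (abs_nonneg _).trans hk
  have hlam := levelSpread_mul hq hqp hpq
  have hz : (Real.log n - k * levelRate p q) / Real.log (p / q) * (2 / √k) =
      √(Real.log n / (k * levelRate p q)) * levelScore p q n k := by
    rw [log_sub_mul_levelRate hq hqp hpq hn, ← hlam, Real.sqrt_div hlog.le, Real.sqrt_mul hk0.le]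
    field_simp
  have hfirst : |Real.log n / (k * levelRate p q) - 1| ≤
      2 * (levelRate p q * levelSpread p q) * A / √(Real.log n) := by
    rw [div_sub_one hkL.ne', log_sub_mul_levelRate hq hqp hpq hn, abs_div, abs_mul,
      abs_of_pos hkL, abs_of_nonneg (by positivity : 0 ≤ levelRate p q * _ * √(Real.log n))]
    calc _ ≤ levelRate p q * levelSpread p q * √(Real.log n) * A / (√(Real.log n) ^ 2 / 2) := by
          gcongr
          rw [hsq]
          exact (hwin k hk).1
      _ = _ := by field_simp
  calc _ = |√(Real.log n / (k * levelRate p q)) - 1| * |levelScore p q n k| := by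
        rw [hz, ← sub_one_mul, abs_mul]
    _ ≤ 2 * (levelRate p q * levelSpread p q) * A / √(Real.log n) * A := by
        gcongr
        exact (abs_sqrt_sub_one_le (by positivity)).trans hfirst
    _ = _ := by ring

theorem exists_abs_meanFill_even_sub_normalCDF_levelScore_le (A : ℝ) :
    ∃ D : ℝ, ∀ᶠ n : ℕ in atTop, ∀ m : ℕ, |levelScore p q n (2 * m)| ≤ A →
      |meanFill p q n (2 * m) - normalCDF (levelScore p q n (2 * m))| ≤ D / √(Real.log n) := by
  have hL := levelRate_pos (hq.trans hqp) hq hpq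
  obtain ⟨E, hE⟩ := exists_abs_mul_sqrt_sub_levelScore_le hq hqp hpq A
  obtain ⟨C, hC⟩ := exists_abs_meanFill_sub_normalCDF_le hq hqp hpq (A + 1)
  obtain ⟨m₀, hm₀⟩ := eventually_atTop.1 hC
  refine ⟨|C| * √(4 * levelRate p q) + E, ?_⟩
  filter_upwards [eventually_ge_atTop 2, hE, eventually_levelRate_mul_mem_Icc hq hqp hpq A,
    eventually_forall_of_abs_levelScore_le hq hqp hpq (eventually_ge_atTop (2 * m₀)) A,
    tendsto_sqrt_log_natCast_atTop.eventually_ge_atTop (max E 1)]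
    with n hn hscore hwin hlarge hs m hm
  have hs0 : 0 < √(Real.log n) := by linarith [le_max_right E 1]
  have hz := hscore _ hm
  set z := (Real.log n - (2 * m : ℕ) * levelRate p q) / Real.log (p / q) * (2 / √(2 * m : ℕ))
  have hzA : |z| ≤ A + 1 := by
    have hE1 : E / √(Real.log n) ≤ 1 := (div_le_one₀ hs0).2 ((le_max_left _ _).trans hs)
    linarith [abs_sub_abs_le_abs_sub z (levelScore p q n (2 * m))]
  have hm0 : m₀ ≤ m := by linarith [hlarge _ hm]
  have hnormal := hm₀ m hm0 n hn z rfl hzA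
  have hsm : √(Real.log n) ≤ √(4 * levelRate p q) * √m := by
    rw [← Real.sqrt_mul (by positivity)]
    refine Real.sqrt_le_sqrt ?_
    have h := (hwin _ hm).1
    push_cast at h
    linarith
  have hmpos : 0 < √(m : ℝ) := pos_of_mul_pos_right (hs0.trans_le hsm) (Real.sqrt_nonneg _)
  have hCm : C / √m ≤ |C| * √(4 * levelRate p q) / √(Real.log n) := by
    rw [div_le_div_iff₀ hmpos hs0, mul_assoc]
    gcongr
    exact le_abs_self C
  calc _ ≤ _ := abs_sub_le _ (normalCDF z) _
    _ ≤ |C| * √(4 * levelRate p q) / √(Real.log n) + E / √(Real.log n) :=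
        add_le_add (hnormal.trans hCm) ((abs_normalCDF_sub_le _ _).trans hz)
    _ = _ := (add_div _ _ _).symm

theorem exists_abs_meanFill_sub_normalCDF_levelScore_le (A : ℝ) :
    ∃ D : ℝ, ∀ᶠ n : ℕ in atTop, ∀ k : ℕ, |levelScore p q n k| ≤ A →
      |meanFill p q n k - normalCDF (levelScore p q n k)| ≤ D / √(Real.log n) := by
  have hc := levelSpread_pos hq hqp hpq
  obtain ⟨D, hD⟩ := exists_abs_meanFill_even_sub_normalCDF_levelScore_le hq hqp hpq (A + 1)
  refine ⟨D + 1 / levelSpread p q, ?_⟩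
  filter_upwards [eventually_ge_atTop 2, hD,
    eventually_forall_of_abs_levelScore_le hq hqp hpq (eventually_ge_atTop 1) A,
    tendsto_sqrt_log_natCast_atTop.eventually_ge_atTop (1 / levelSpread p q)]
    with n hn heven hlarge hs k hk
  have hanti := antitone_meanFill (hq.trans hqp).le hq.le hpq hn
  have hstep : 1 / levelSpread p q / √(Real.log n) ≤ 1 :=
    div_le_one_of_le₀ hs (Real.sqrt_nonneg _)
  have hnear : ∀ l : ℕ, |(k : ℝ) - l| ≤ 1 → Even l →
      |meanFill p q n l - normalCDF (levelScore p q n k)| ≤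
        (D + 1 / levelSpread p q) / √(Real.log n) := by
    rintro l hkl hl
    obtain ⟨m, rfl⟩ := hl.exists_two_nsmul
    rw [smul_eq_mul] at *
    have hscore : |levelScore p q n (2 * m) - levelScore p q n k| ≤
        1 / levelSpread p q / √(Real.log n) := by
      rw [levelScore_sub, abs_div, abs_of_nonneg (by positivity : 0 ≤ _ * √(Real.log n)), div_div]
      gcongr
    have hm : |levelScore p q n (2 * m)| ≤ A + 1 := by
      linarith [abs_sub_abs_le_abs_sub (levelScore p q n (2 * m)) (levelScore p q n k)]
    rw [add_div]
    exact (abs_sub_le _ (normalCDF (levelScore p q n (2 * m))) _).trans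
      (add_le_add (heven m hm) ((abs_normalCDF_sub_le _ _).trans hscore))
  rcases Nat.even_or_odd k with hk2 | hk2
  · exact hnear k (by simp) hk2
  · have hk1 := hlarge k hk
    have hbefore := abs_le.1
      (hnear (k - 1) (by simp [Nat.cast_pred hk1]) (Nat.Odd.sub_odd hk2 odd_one))
    have hafter := abs_le.1 (hnear (k + 1) (by simp) hk2.add_one)
    rw [abs_le]
    constructor <;> linarith [hanti (k.sub_le 1), hanti (Nat.le_add_right k 1)]

theorem exists_abs_half_sub_cellThreshold_le (A : ℝ) :
    ∃ D ≥ 0, ∀ᶠ n : ℕ in atTop, ∀ k : ℕ, |levelScore p q n k| ≤ A →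
      |(k : ℝ) / 2 - cellThreshold p q n k| ≤ D * √k := by
  have hL := levelRate_pos (hq.trans hqp) hq hpq
  have hc := levelSpread_pos hq hqp hpq
  have hlam := log_div_pos hq hqp
  refine ⟨levelRate p q * levelSpread p q * √(2 * levelRate p q) * |A| / Real.log (p / q),
    by positivity, ?_⟩
  filter_upwards [eventually_ge_atTop 2, eventually_levelRate_mul_mem_Icc hq hqp hpq A]
    with n hn hwin k hk
  have hsqrt : √(Real.log n) ≤ √(2 * levelRate p q) * √k := by
    rw [← Real.sqrt_mul (by positivity)]
    exact Real.sqrt_le_sqrt (by linarith [(hwin k hk).1])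
  rw [half_sub_cellThreshold hq hqp, abs_div, abs_of_pos hlam, div_mul_eq_mul_div,
    log_sub_mul_levelRate hq hqp hpq hn, abs_mul, abs_of_nonneg (by positivity)]
  refine div_le_div_of_nonneg_right ?_ hlam.le
  calc _ ≤ levelRate p q * levelSpread p q * (√(2 * levelRate p q) * √k) * |A| :=
        mul_le_mul (by gcongr) (hk.trans (le_abs_self A)) (abs_nonneg _) (by positivity)
    _ = _ := by ring

theorem exists_div_sqrt_log_le_meanFill_sub_succ (A : ℝ) :
    ∃ d > 0, ∀ᶠ n : ℕ in atTop, ∀ k : ℕ, |levelScore p q n k| ≤ A →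
      d / √(Real.log n) ≤ meanFill p q n k - meanFill p q n (k + 1) := by
  have hp := hq.trans hqp
  have hL := levelRate_pos hp hq hpq
  have hlam := log_div_pos hq hqp
  obtain ⟨D, hD0, hD⟩ := exists_abs_half_sub_cellThreshold_le hq hqp hpq A
  obtain ⟨c, hc, hbinom⟩ := exists_div_sqrt_le_binomProb (D + 1)
  obtain ⟨b, hb, hdrop⟩ := exists_le_cellDrop hq hqp hpq
  have hsqrt : Tendsto (fun k : ℕ => √(k : ℝ)) atTop atTop :=
    Real.tendsto_sqrt_atTop.comp tendsto_natCast_atTop_atTop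
  refine ⟨c * b / √(2 / levelRate p q), by positivity, ?_⟩
  filter_upwards [eventually_ge_atTop 2, hD, hdrop, eventually_levelRate_mul_mem_Icc hq hqp hpq A,
    eventually_forall_of_abs_levelScore_le hq hqp hpq hbinom A,
    eventually_forall_of_abs_levelScore_le hq hqp hpq
      (hsqrt.eventually_ge_atTop (2 * D + 2)) A] with n hn hτ hdrop hwin hbinom hlarge k hk
  obtain ⟨hτ0, hjk, hj⟩ := ceil_le_and_abs_half_sub_ceil_le hD0 (hlarge k hk) (hτ k hk)
  set τ := cellThreshold p q n k with hτ_def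
  have hk0 : 0 < √(k : ℝ) := by linarith [hlarge k hk]
  have hexp := mul_cellProb_eq_exp hq hqp (show n ≠ 0 by lia) hjk
  rw [← hτ_def] at hexp
  have hcell := hdrop (p ^ ⌈τ⌉₊ * q ^ (k - ⌈τ⌉₊))
    (hexp ▸ Real.one_le_exp (mul_nonneg hlam.le (sub_nonneg.2 (Nat.le_ceil τ))))
    (by
      rw [hexp, ← Real.le_log_iff_exp_le (div_pos hp hq)]
      exact mul_le_of_le_one_right hlam.le (by linarith [Nat.ceil_lt_add_one hτ0]))
  have hlog : √k ≤ √(2 / levelRate p q) * √(Real.log n) := by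
    rw [← Real.sqrt_mul (by positivity), div_mul_eq_mul_div]
    exact Real.sqrt_le_sqrt ((le_div_iff₀ hL).2 (hwin k hk).2)
  calc c * b / √(2 / levelRate p q) / √(Real.log n)
      = c * b / (√(2 / levelRate p q) * √(Real.log n)) := div_div _ _ _
    _ ≤ c * b / √k := by gcongr
    _ = c / √k * b := by ring
    _ ≤ binomProb k ⌈τ⌉₊ * cellDrop p q n (p ^ ⌈τ⌉₊ * q ^ (k - ⌈τ⌉₊)) := by
        gcongr
        exacts [(by positivity : 0 ≤ c / √k).trans (hbinom k hk _ hj), hbinom k hk _ hj]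
    _ ≤ _ := binomProb_mul_cellDrop_le hp.le hq.le hpq hn hjk

end Biased

/-! ### Crossing of the mean fill proportion -/

/-- The (real) level whose standardized level is `a`. -/
noncomputable def criticalLevel (p q a : ℝ) (n : ℕ) : ℝ :=
  Real.logb (1 / √(p * q)) n - levelSpread p q * a * √(Real.log n)

theorem criticalLevel_comm (p q a : ℝ) (n : ℕ) :
    criticalLevel p q a n = criticalLevel q p a n := by
  rw [criticalLevel, criticalLevel, levelSpread_comm, mul_comm p]

theorem eventually_log_div_le_criticalLevel {p q : ℝ} (hp : 0 < p) (hq : 0 < q) (hpq : p + q = 1)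
    (a : ℝ) :
    ∀ᶠ n : ℕ in atTop, Real.log n / (2 * levelRate p q) ≤ criticalLevel p q a n := by
  have hL := levelRate_pos hp hq hpq
  filter_upwards [tendsto_sqrt_log_natCast_atTop.eventually_ge_atTop
    (levelSpread p q * a * (2 * levelRate p q))] with n hn
  have hlog : √(Real.log n) * √(Real.log n) = Real.log n :=
    Real.mul_self_sqrt (Real.log_natCast_nonneg n)
  have hspread : levelSpread p q * a * √(Real.log n) ≤ Real.log n / (2 * levelRate p q) := by
    rw [le_div_iff₀ (by positivity), mul_right_comm]
    exact (mul_le_mul_of_nonneg_right hn (Real.sqrt_nonneg _)).trans_eq hlog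
  have hsum : Real.log n / levelRate p q =
      Real.log n / (2 * levelRate p q) + Real.log n / (2 * levelRate p q) := by
    field_simp
    norm_num
  rw [criticalLevel, Real.logb, ← levelRate]
  linarith

theorem exists_two_step_crossing {u : ℕ → ℝ} {κ T t δ : ℝ} (hδ : 0 < δ) (hT : 0 ≤ T) (hκ : T ≤ κ)
    (habove : ∀ k : ℕ, |k - κ| ≤ T + 1 → k ≤ κ - T → t + δ ≤ u k)
    (hbelow : ∀ k : ℕ, |k - κ| ≤ T + 1 → κ + T ≤ k → u k ≤ t - δ)
    (hdrop : ∀ k : ℕ, |k - κ| ≤ T + 1 → 2 * δ ≤ u k - u (k + 1)) :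
    ∃ k : ℕ, |k - κ| ≤ T + 1 ∧ t + δ ≤ u k ∧ u (k + 2) ≤ t - δ := by
  set k₁ := ⌊κ - T⌋₊
  set k₂ := ⌈κ + T⌉₊
  have hk₁ : (k₁ : ℝ) ≤ κ - T := Nat.floor_le (by linarith)
  have hk₁' : κ - T < k₁ + 1 := Nat.lt_floor_add_one _
  have hk₂ : κ + T ≤ k₂ := Nat.le_ceil _
  have hk₂' : (k₂ : ℝ) < κ + T + 1 := Nat.ceil_lt_add_one (by linarith)
  have hwindow : ∀ k : ℕ, k₁ ≤ k → k ≤ k₂ → |k - κ| ≤ T + 1 := fun k h₁ h₂ => by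
    have h₁' : (k₁ : ℝ) ≤ k := by exact_mod_cast h₁
    have h₂' : (k : ℝ) ≤ k₂ := by exact_mod_cast h₂
    exact abs_le.2 ⟨by linarith, by linarith⟩
  have hk₁₂ : k₁ ≤ k₂ := by exact_mod_cast (by linarith : (k₁ : ℝ) ≤ k₂)
  have hu₁ := habove k₁ (hwindow _ le_rfl hk₁₂) hk₁
  have hu₂ := hbelow k₂ (hwindow _ hk₁₂ le_rfl) hk₂
  by_contra! hno
  -- Without a crossing in two steps, staying above `t + δ` propagates from `k₁` to `k₂`.
  have hstay : ∀ k, k₁ ≤ k → k ≤ k₂ → t + δ ≤ u k := by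
    intro k hk
    induction k, hk using Nat.le_induction with
    | base => exact fun _ => hu₁
    | succ k hk ih =>
      intro hk'
      have := hno k (hwindow k hk (by lia)) (ih (by lia))
      linarith [hdrop (k + 1) (hwindow _ (by lia) hk')]
  linarith [hstay k₂ hk₁₂ le_rfl]

section Biased

variable {p q : ℝ} (hq : 0 < q) (hqp : q < p) (hpq : p + q = 1)
include hq hqp hpq

theorem levelScore_sub_eq {n : ℕ} (hn : 2 ≤ n) (a : ℝ) (k : ℕ) :
    levelScore p q n k - a = (criticalLevel p q a n - k) / (levelSpread p q * √(Real.log n)) := by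
  have hc := levelSpread_pos hq hqp hpq
  have hlog : 0 < Real.log n := Real.log_pos (by exact_mod_cast hn)
  rw [levelScore, criticalLevel]
  field_simp
  ring

theorem abs_levelScore_sub_le {n : ℕ} (hn : 2 ≤ n) {a T : ℝ} {k : ℕ}
    (hk : |k - criticalLevel p q a n| ≤ T) :
    |levelScore p q n k - a| ≤ T / levelSpread p q / √(Real.log n) := by
  have hc := levelSpread_pos hq hqp hpq
  rw [levelScore_sub_eq hq hqp hpq hn, abs_div, abs_sub_comm,
    abs_of_nonneg (by positivity : 0 ≤ levelSpread p q * _), div_div]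
  gcongr

theorem eventually_abs_levelScore_le (a T : ℝ) :
    ∀ᶠ n : ℕ in atTop, ∀ k : ℕ, |k - criticalLevel p q a n| ≤ T →
      |levelScore p q n k| ≤ |a| + 1 := by
  filter_upwards [eventually_ge_atTop 2, tendsto_sqrt_log_natCast_atTop.eventually_ge_atTop
    (T / levelSpread p q)] with n hn hs k hk
  have hnear := (abs_levelScore_sub_le hq hqp hpq hn hk).trans
    (div_le_one_of_le₀ hs (Real.sqrt_nonneg _))
  linarith [abs_sub_abs_le_abs_sub (levelScore p q n k) a]

/-- At a large but bounded distance from the critical level, the change of the Gaussian main term,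
of order `1 / √(log n)`, exceeds the error of the normal approximation. -/
theorem exists_meanFill_margin (a : ℝ) :
    ∃ T ≥ 0, ∀ᶠ n : ℕ in atTop, ∀ k : ℕ, |k - criticalLevel p q a n| ≤ T + 1 →
      (k ≤ criticalLevel p q a n - T → normalCDF a + 1 / √(Real.log n) ≤ meanFill p q n k) ∧
      (criticalLevel p q a n + T ≤ k → meanFill p q n k ≤ normalCDF a - 1 / √(Real.log n)) := by
  have hc := levelSpread_pos hq hqp hpq
  obtain ⟨D, hD⟩ := exists_abs_meanFill_sub_normalCDF_levelScore_le hq hqp hpq (|a| + 1)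
  set φ := gaussianPDFReal 0 1 (|a| + 1)
  have hφ : 0 < φ := gaussianPDFReal_pos _ _ _ one_ne_zero
  refine ⟨levelSpread p q * ((|D| + 1) / φ), by positivity, ?_⟩
  filter_upwards [eventually_ge_atTop 2, hD, eventually_abs_levelScore_le hq hqp hpq a
    (levelSpread p q * ((|D| + 1) / φ) + 1)] with n hn hnormal hA k hk
  have hs : 0 < √(Real.log n) := Real.sqrt_pos.2 (Real.log_pos (by exact_mod_cast hn))
  have hscore := levelScore_sub_eq hq hqp hpq hn a k
  have hAk := abs_le.1 (hA k hk)
  have herr := abs_le.1 ((hnormal k (hA k hk)).trans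
    (div_le_div_of_nonneg_right (le_abs_self D) hs.le))
  have hmargin : φ * (levelSpread p q * ((|D| + 1) / φ) / (levelSpread p q * √(Real.log n))) =
      |D| / √(Real.log n) + 1 / √(Real.log n) := by
    field_simp
  have hM : 0 ≤ levelSpread p q * ((|D| + 1) / φ) / (levelSpread p q * √(Real.log n)) := by
    positivity
  constructor <;> intro hkT
  · have hstep : levelSpread p q * ((|D| + 1) / φ) / (levelSpread p q * √(Real.log n)) ≤
        levelScore p q n k - a := by
      rw [hscore]
      gcongr
      linarith
    have hgain := le_normalCDF_sub (A := |a| + 1) (by linarith [neg_abs_le a])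
      (sub_nonneg.1 (hM.trans hstep)) hAk.2
    linarith [mul_le_mul_of_nonneg_left hstep hφ.le]
  · have hstep : levelSpread p q * ((|D| + 1) / φ) / (levelSpread p q * √(Real.log n)) ≤
        a - levelScore p q n k := by
      rw [← neg_sub, hscore, ← neg_div]
      gcongr
      linarith
    have hgain := le_normalCDF_sub (A := |a| + 1) hAk.1
      (sub_nonneg.1 (hM.trans hstep)) (by linarith [le_abs_self a])
    linarith [mul_le_mul_of_nonneg_left hstep hφ.le]

theorem exists_abs_meanFill_sub_normalCDF_le_of_near (a T : ℝ) :
    ∃ C : ℝ, ∀ᶠ n : ℕ in atTop, ∀ k : ℕ, |k - criticalLevel p q a n| ≤ T →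
      |meanFill p q n k - normalCDF a| ≤ C / √(Real.log n) := by
  obtain ⟨D, hD⟩ := exists_abs_meanFill_sub_normalCDF_levelScore_le hq hqp hpq (|a| + 1)
  refine ⟨D + T / levelSpread p q, ?_⟩
  filter_upwards [eventually_ge_atTop 2, hD, eventually_abs_levelScore_le hq hqp hpq a T]
    with n hn hnormal hA k hk
  rw [add_div]
  exact (abs_sub_le _ (normalCDF (levelScore p q n k)) _).trans (add_le_add (hnormal k (hA k hk))
    ((abs_normalCDF_sub_le _ _).trans (abs_levelScore_sub_le hq hqp hpq hn hk)))

theorem exists_meanFill_crossing_of_lt (a : ℝ) :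
    ∃ T C : ℝ, ∀ᶠ n : ℕ in atTop, ∃ k : ℕ, |k - criticalLevel p q a n| ≤ T ∧
      (normalCDF a + 1 / Real.log n ≤ meanFill p q n k ∧
        meanFill p q n (k + 2) ≤ normalCDF a - 1 / Real.log n) ∧
      |meanFill p q n k - normalCDF a| ≤ C / √(Real.log n) := by
  have hL := levelRate_pos (hq.trans hqp) hq hpq
  obtain ⟨T, hT0, hT⟩ := exists_meanFill_margin hq hqp hpq a
  obtain ⟨d, hd0, hd⟩ := exists_div_sqrt_log_le_meanFill_sub_succ hq hqp hpq (|a| + 1)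
  obtain ⟨C, hC⟩ := exists_abs_meanFill_sub_normalCDF_le_of_near hq hqp hpq a (T + 1)
  refine ⟨T + 1, C, ?_⟩
  filter_upwards [hT, hd, hC, eventually_abs_levelScore_le hq hqp hpq a (T + 1),
    eventually_log_div_le_criticalLevel (hq.trans hqp) hq hpq a,
    (Real.tendsto_log_atTop.comp tendsto_natCast_atTop_atTop).eventually_ge_atTop
      (T * (2 * levelRate p q)),
    tendsto_sqrt_log_natCast_atTop.eventually_ge_atTop (max 1 (2 / d))]
    with n hmargin hdrop hnear hA hκ hlog hs
  have hs1 : 1 ≤ √(Real.log n) := (le_max_left _ _).trans hs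
  have hs0 : 0 < √(Real.log n) := zero_lt_one.trans_le hs1
  have hlog0 : 0 < Real.log n := Real.sqrt_pos.1 hs0
  have hδ : 1 / Real.log n = 1 / √(Real.log n) / √(Real.log n) := by
    rw [div_div, Real.mul_self_sqrt hlog0.le]
  have hδ1 : 1 / Real.log n ≤ 1 / √(Real.log n) := by
    rw [hδ]
    exact div_le_self (by positivity) hs1
  have hδd : 2 * (1 / Real.log n) ≤ d / √(Real.log n) := by
    rw [hδ, ← mul_div_assoc, mul_one_div]
    gcongr
    exact (div_le_comm₀ hd0 hs0).1 ((le_max_right _ _).trans hs)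
  obtain ⟨k, hk, hcross⟩ := exists_two_step_crossing (u := meanFill p q n) (t := normalCDF a)
    (one_div_pos.2 hlog0) hT0 (((le_div_iff₀ (by positivity)).2 hlog).trans hκ)
    (fun k hk hkT => by linarith [(hmargin k hk).1 hkT])
    (fun k hk hkT => by linarith [(hmargin k hk).2 hkT])
    (fun k hk => hδd.trans (hdrop k (hA k hk)))
  exact ⟨k, hk, hcross, hnear k hk⟩

end Biased

theorem meanFill_half (n k : ℕ) :
    meanFill (1 / 2) (1 / 2) n k = 1 - atMostOneProb n ((1 / 2) ^ k) := by
  simp only [meanFill, cellAverage, ite_self, Finset.prod_const, Finset.sum_const,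
    Finset.card_univ, Fintype.card_fin, Fintype.card_pi_const, Fintype.card_bool, nsmul_eq_mul,
    Nat.cast_pow, Nat.cast_ofNat]
  exact mul_div_cancel_left₀ _ (by positivity)

theorem criticalLevel_half (a : ℝ) (n : ℕ) :
    criticalLevel (1 / 2) (1 / 2) a n = Real.logb 2 n := by
  rw [criticalLevel, levelSpread, Real.sqrt_mul_self (by norm_num)]
  norm_num

theorem natCast_mul_half_pow {n : ℕ} (hn : n ≠ 0) (k : ℕ) :
    (n : ℝ) * (1 / 2) ^ k = 2 ^ (Real.logb 2 n - k) := by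
  rw [Real.rpow_sub two_pos, Real.rpow_logb two_pos (by norm_num) (by positivity),
    Real.rpow_natCast, one_div, inv_pow, div_eq_mul_inv]

theorem exists_le_meanFill_half_sub_succ (T : ℝ) :
    ∃ b > 0, ∀ᶠ n : ℕ in atTop, ∀ k : ℕ, |k - Real.logb 2 n| ≤ T →
      b ≤ meanFill (1 / 2) (1 / 2) n k - meanFill (1 / 2) (1 / 2) n (k + 1) := by
  refine ⟨1 / 2 * (1 - 1 / 2) * ((2 ^ (-T)) ^ 2 / 2 * Real.exp (-(2 * 2 ^ T))), by positivity, ?_⟩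
  filter_upwards [eventually_ge_atTop 2,
    tendsto_natCast_atTop_atTop.eventually_ge_atTop (2 * (2 : ℝ) ^ T)] with n hn hnT k hk
  have hκ := abs_le.1 hk
  have hy := natCast_mul_half_pow (show n ≠ 0 by lia) k
  have hlow : (2 : ℝ) ^ (-T) ≤ n * (1 / 2) ^ k :=
    hy ▸ Real.rpow_le_rpow_of_exponent_le one_le_two (by linarith)
  have hupp : n * (1 / 2) ^ k ≤ (2 : ℝ) ^ T :=
    hy ▸ Real.rpow_le_rpow_of_exponent_le one_le_two (by linarith)
  have hhalf : ((1 : ℝ) / 2) ^ k ≤ 1 / 2 :=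
    le_of_mul_le_mul_left (by linarith) (show (0 : ℝ) < n by positivity)
  have hdrop := le_atMostOneProb_mul_sub hn (by norm_num : (0 : ℝ) ≤ 1 / 2) (by norm_num)
    (by positivity) hhalf
  rw [← pow_succ'] at hdrop
  rw [meanFill_half, meanFill_half, sub_sub_sub_cancel_left]
  refine le_trans ?_ hdrop
  gcongr

theorem exists_meanFill_half_margin {α : ℝ} (hα0 : 0 < α) (hα1 : α < 1) :
    ∃ T ≥ 0, ∀ᶠ n : ℕ in atTop, ∀ k : ℕ,
      (k ≤ Real.logb 2 n - T → α + 1 / Real.log n ≤ meanFill (1 / 2) (1 / 2) n k) ∧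
      (Real.logb 2 n + T ≤ k → meanFill (1 / 2) (1 / 2) n k ≤ α - 1 / Real.log n) := by
  set ε := min α (1 - α) / 2 with hε
  have hε0 : 0 < ε := half_pos (lt_min hα0 (sub_pos.2 hα1))
  have hεα : 2 * ε ≤ α := by linarith [min_le_left α (1 - α)]
  have hεα' : 2 * ε ≤ 1 - α := by linarith [min_le_right α (1 - α)]
  obtain ⟨T, hT⟩ := pow_unbounded_of_one_lt (9 / ε) (one_lt_two (α := ℝ))
  rw [← Real.rpow_natCast] at hT
  refine ⟨T, T.cast_nonneg, ?_⟩
  filter_upwards [eventually_ge_atTop 2,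
    (Real.tendsto_log_atTop.comp tendsto_natCast_atTop_atTop).eventually_ge_atTop (1 / ε)]
    with n hn hlog k
  have hδ : 1 / Real.log n ≤ ε :=
    (one_div_le (Real.log_pos (by exact_mod_cast hn)) hε0).2 hlog
  have hx0 : (0 : ℝ) < (1 / 2) ^ k := by positivity
  have hx1 : ((1 : ℝ) / 2) ^ k ≤ 1 := pow_le_one₀ (by norm_num) (by norm_num)
  have hy := natCast_mul_half_pow (show n ≠ 0 by lia) k
  have hy0 : (0 : ℝ) < n * (1 / 2) ^ k := by positivity
  rw [meanFill_half]
  constructor <;> intro hk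
  · have hlarge : 9 / ε ≤ n * (1 / 2) ^ k :=
      hT.le.trans (hy ▸ Real.rpow_le_rpow_of_exponent_le one_le_two (by linarith))
    linarith [atMostOneProb_le_div hn hx0 hx1, (div_le_comm₀ hy0 hε0).2 hlarge]
  · have hsmall : 9 / ε * (n * (1 / 2) ^ k) ≤ 1 := by
      calc _ ≤ (2 : ℝ) ^ (T : ℝ) * 2 ^ (-(T : ℝ)) := by
            rw [hy]
            gcongr
            exacts [one_le_two, by linarith]
        _ = 1 := by rw [← Real.rpow_add two_pos, add_neg_cancel, Real.rpow_zero]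
    rw [div_mul_eq_mul_div, div_le_one₀ hε0] at hsmall
    have : ε ≤ 1 := by linarith
    linarith [one_sub_atMostOneProb_le (n := n) hx0.le hx1,
      pow_le_of_le_one hy0.le (show (n : ℝ) * (1 / 2) ^ k ≤ 1 by linarith) two_ne_zero]

theorem exists_meanFill_half_crossing {α : ℝ} (hα0 : 0 < α) (hα1 : α < 1) :
    ∃ T : ℝ, ∀ᶠ n : ℕ in atTop, ∃ k : ℕ, |k - Real.logb 2 n| ≤ T ∧
      (α + 1 / Real.log n ≤ meanFill (1 / 2) (1 / 2) n k ∧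
        meanFill (1 / 2) (1 / 2) n (k + 2) ≤ α - 1 / Real.log n) := by
  obtain ⟨T, hT0, hT⟩ := exists_meanFill_half_margin hα0 hα1
  obtain ⟨b, hb0, hb⟩ := exists_le_meanFill_half_sub_succ (T + 1)
  refine ⟨T + 1, ?_⟩
  filter_upwards [eventually_ge_atTop 2, hT, hb,
    ((Real.tendsto_logb_atTop one_lt_two).comp tendsto_natCast_atTop_atTop).eventually_ge_atTop T,
    (Real.tendsto_log_atTop.comp tendsto_natCast_atTop_atTop).eventually_ge_atTop (2 / b)]
    with n hn hmargin hdrop hκ hlog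
  have hlog0 : 0 < Real.log n := Real.log_pos (by exact_mod_cast hn)
  have hδ : 2 * (1 / Real.log n) ≤ b := by
    rw [mul_one_div]
    exact (div_le_comm₀ hlog0 hb0).2 hlog
  exact exists_two_step_crossing (one_div_pos.2 hlog0) hT0 hκ (fun k _ => (hmargin k).1)
    (fun k _ => (hmargin k).2) fun k hk => hδ.trans (hdrop k hk)

theorem exists_meanFill_crossing {p q a : ℝ} (hp : 0 < p) (hq : 0 < q) (hpq : p + q = 1)
    (ha0 : 0 < normalCDF a) (ha1 : normalCDF a < 1) :
    ∃ T C : ℝ, ∀ᶠ n : ℕ in atTop, ∃ k : ℕ, |k - criticalLevel p q a n| ≤ T ∧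
      (normalCDF a + 1 / Real.log n ≤ meanFill p q n k ∧
        meanFill p q n (k + 2) ≤ normalCDF a - 1 / Real.log n) ∧
      (p ≠ 1 / 2 → |meanFill p q n k - normalCDF a| ≤ C / √(Real.log n)) := by
  rcases lt_trichotomy q p with h | h | h
  · obtain ⟨T, C, hTC⟩ := exists_meanFill_crossing_of_lt hq h hpq a
    exact ⟨T, C, hTC.mono fun n ⟨k, hk, hcross, hmean⟩ => ⟨k, hk, hcross, fun _ => hmean⟩⟩
  · obtain ⟨T, hT⟩ := exists_meanFill_half_crossing ha0 ha1
    obtain ⟨rfl, rfl⟩ : p = 1 / 2 ∧ q = 1 / 2 := ⟨by linarith, by linarith⟩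
    refine ⟨T, 0, hT.mono fun n ⟨k, hk, hcross⟩ => ⟨k, ?_, hcross, fun h => absurd rfl h⟩⟩
    rwa [criticalLevel_half]
  · obtain ⟨T, C, hTC⟩ := exists_meanFill_crossing_of_lt hp h (by rwa [add_comm]) a
    simp only [criticalLevel_comm q p, meanFill_comm q p] at hTC
    exact ⟨T, C, hTC.mono fun n ⟨k, hk, hcross, hmean⟩ => ⟨k, hk, hcross, fun _ => hmean⟩⟩

theorem one_div_sqrt_log_isBigO_one_div_sqrt_logb :
    (fun n : ℕ => 1 / √(Real.log n)) =O[atTop] fun n : ℕ => 1 / √(Real.logb 2 n) := by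
  have hlog2 : 0 < √(Real.log 2) := Real.sqrt_pos.2 (Real.log_pos one_lt_two)
  have heq : (fun n : ℕ => 1 / √(Real.logb 2 n)) = fun n : ℕ => √(Real.log 2) *
      (1 / √(Real.log n)) := by
    funext n
    rw [Real.logb, Real.sqrt_div (Real.log_natCast_nonneg n), one_div_div, mul_one_div]
  rw [heq]
  exact isBigO_self_const_mul hlog2.ne' _ _

theorem exists_fillupSequence {p q a : ℝ} (hp : 0 < p) (hq : 0 < q) (hpq : p + q = 1)
    (ha0 : 0 < normalCDF a) (ha1 : normalCDF a < 1) :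
    ∃ k : ℕ → ℕ,
      ((fun n => (k n : ℝ) - criticalLevel p q a n) =O[atTop] fun _ => (1 : ℝ)) ∧
      (∀ᶠ n : ℕ in atTop, normalCDF a + 1 / Real.log n ≤ meanFill p q n (k n) ∧
        meanFill p q n (k n + 2) ≤ normalCDF a - 1 / Real.log n) ∧
      (p ≠ 1 / 2 → (fun n => meanFill p q n (k n) - normalCDF a) =O[atTop]
        fun n : ℕ => 1 / √(Real.logb 2 n)) := by
  obtain ⟨T, C, hTC⟩ := exists_meanFill_crossing hp hq hpq ha0 ha1
  obtain ⟨k, hk⟩ := hTC.choice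
  refine ⟨k, IsBigO.of_bound T (hk.mono fun n h => ?_), hk.mono fun n h => h.2.1, fun hp2 => ?_⟩
  · simpa only [Real.norm_eq_abs, norm_one, mul_one] using h.1
  · refine IsBigO.trans (IsBigO.of_bound C (hk.mono fun n h => ?_))
      one_div_sqrt_log_isBigO_one_div_sqrt_logb
    rw [Real.norm_eq_abs, Real.norm_of_nonneg (by positivity), mul_one_div]
    exact h.2.2 hp2

/-! ### The Efron–Stein inequality -/

section EfronStein

section Factors

variable {Ω Ω' : Type*} [MeasurableSpace Ω] [MeasurableSpace Ω'] {μ : Measure Ω} {ν : Measure Ω'}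
  [IsProbabilityMeasure μ] [IsProbabilityMeasure ν]

theorem sq_integral_le_integral_sq {f : Ω → ℝ} (hf : MemLp f 2 μ) :
    (∫ x, f x ∂μ) ^ 2 ≤ ∫ x, f x ^ 2 ∂μ := by
  have h := variance_nonneg f μ
  rw [variance_eq_sub hf] at h
  exact sub_nonneg.1 h

theorem variance_le_integral_sub_const_sq {f : Ω → ℝ} (hf : AEStronglyMeasurable f μ) (c : ℝ) :
    Var[f; μ] ≤ ∫ x, (f x - c) ^ 2 ∂μ := by
  rw [← variance_sub_const hf c]
  exact variance_le_expectation_sq (hf.sub aestronglyMeasurable_const)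

theorem ae_memLp_two_section {f : Ω × Ω' → ℝ} (hf : MemLp f 2 (μ.prod ν)) :
    ∀ᵐ x ∂μ, MemLp (fun y => f (x, y)) 2 ν := by
  filter_upwards [hf.1.prodMk_left, hf.integrable_sq.prod_right_ae] with x hx hx2
  exact (memLp_two_iff_integrable_sq hx).2 hx2

theorem memLp_two_integral_section {f : Ω × Ω' → ℝ} (hf : MemLp f 2 (μ.prod ν)) :
    MemLp (fun x => ∫ y, f (x, y) ∂ν) 2 μ := by
  have hm : AEStronglyMeasurable (fun x => ∫ y, f (x, y) ∂ν) μ := hf.1.integral_prod_right'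
  refine (memLp_two_iff_integrable_sq hm).2
    (hf.integrable_sq.integral_prod_left.mono' (hm.pow 2) ?_)
  filter_upwards [ae_memLp_two_section hf] with x hx
  simpa only [Real.norm_eq_abs, abs_sq] using sq_integral_le_integral_sq hx

theorem variance_prod {f : Ω × Ω' → ℝ} (hf : MemLp f 2 (μ.prod ν)) :
    Var[f; μ.prod ν] =
      ∫ x, Var[fun y => f (x, y); ν] ∂μ + Var[fun x => ∫ y, f (x, y) ∂ν; μ] := by
  have hmean := memLp_two_integral_section hf
  have hsection : ∀ᵐ x ∂μ, Var[fun y => f (x, y); ν] =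
      ∫ y, f (x, y) ^ 2 ∂ν - (∫ y, f (x, y) ∂ν) ^ 2 := by
    filter_upwards [ae_memLp_two_section hf] with x hx
    exact variance_eq_sub hx
  rw [integral_congr_ae hsection,
    integral_sub hf.integrable_sq.integral_prod_left hmean.integrable_sq, variance_eq_sub hf,
    variance_eq_sub hmean]
  simp only [Pi.pow_apply]
  rw [integral_prod _ hf.integrable_sq, integral_prod _ (hf.integrable one_le_two)]
  ring

theorem variance_integral_section_le {f : Ω × Ω' → ℝ} {g : Ω' → ℝ}
    (hf : MemLp f 2 (μ.prod ν)) (hg : MemLp g 2 ν) :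
    Var[fun x => ∫ y, f (x, y) ∂ν; μ] ≤ ∫ z, (f z - g z.2) ^ 2 ∂(μ.prod ν) := by
  have hfg : MemLp (fun z : Ω × Ω' => f z - g z.2) 2 (μ.prod ν) :=
    hf.sub (hg.comp_snd μ)
  have hmean := memLp_two_integral_section hf
  calc Var[fun x => ∫ y, f (x, y) ∂ν; μ]
      ≤ ∫ x, (∫ y, f (x, y) ∂ν - ∫ y, g y ∂ν) ^ 2 ∂μ :=
        variance_le_integral_sub_const_sq hmean.1 _
    _ ≤ ∫ x, ∫ y, (f (x, y) - g y) ^ 2 ∂ν ∂μ := by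
        refine integral_mono_ae (hmean.sub (memLp_const _)).integrable_sq
          hfg.integrable_sq.integral_prod_left ?_
        filter_upwards [ae_memLp_two_section hf] with x hx
        rw [← integral_sub (hx.integrable one_le_two) (hg.integrable one_le_two)]
        exact sq_integral_le_integral_sq (hx.sub hg)
    _ = ∫ z, (f z - g z.2) ^ 2 ∂(μ.prod ν) := (integral_prod _ hfg.integrable_sq).symm

theorem variance_prod_le_integral_sub_sq_add {f g : Ω × Ω' → ℝ} (hf : MemLp f 2 (μ.prod ν))
    (hg : MemLp g 2 (μ.prod ν)) (hgx : ∀ x x' y, g (x, y) = g (x', y)) :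
    Var[f; μ.prod ν] ≤
      ∫ z, (f z - g z) ^ 2 ∂(μ.prod ν) + ∫ x, Var[fun y => f (x, y); ν] ∂μ := by
  obtain ⟨x₀, hx₀⟩ := (ae_memLp_two_section hg).exists
  have hg_eq : (fun z => (f z - g z) ^ 2) = fun z : Ω × Ω' => (f z - g (x₀, z.2)) ^ 2 :=
    funext fun z => by rw [hgx x₀ z.1 z.2]
  rw [variance_prod hf, add_comm, hg_eq]
  gcongr
  exact variance_integral_section_le hf hx₀

theorem integral_variance_section_le {ι : Type*} [Fintype ι] {f : Ω × Ω' → ℝ}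
    {g : ι → Ω × Ω' → ℝ} (hf : MemLp f 2 (μ.prod ν)) (hg : ∀ i, MemLp (g i) 2 (μ.prod ν))
    (hsection : ∀ᵐ x ∂μ, Var[fun y => f (x, y); ν] ≤
      ∑ i, ∫ y, (f (x, y) - g i (x, y)) ^ 2 ∂ν) :
    ∫ x, Var[fun y => f (x, y); ν] ∂μ ≤ ∑ i, ∫ z, (f z - g i z) ^ 2 ∂(μ.prod ν) := by
  have hintegrable : ∀ i, Integrable (fun z => (f z - g i z) ^ 2) (μ.prod ν) :=
    fun i => (hf.sub (hg i)).integrable_sq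
  simp_rw [integral_prod _ (hintegrable _)]
  rw [← integral_finsetSum _ fun i _ => (hintegrable i).integral_prod_left]
  exact integral_mono_of_nonneg (.of_forall fun _ => variance_nonneg _ _)
    (integrable_finsetSum _ fun i _ => (hintegrable i).integral_prod_left) hsection

end Factors

/-- Efron–Stein: adding one coordinate costs the variance of the average over the others, and a
function that ignores the new coordinate can be subtracted from that average for free. -/
theorem variance_pi_le_sum_integral_sub_sq {n : ℕ} {Ω : Fin n → Type*}
    [∀ i, MeasurableSpace (Ω i)] {μ : ∀ i, Measure (Ω i)} [∀ i, IsProbabilityMeasure (μ i)]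
    {f : (∀ i, Ω i) → ℝ} {g : Fin n → (∀ i, Ω i) → ℝ} (hf : MemLp f 2 (Measure.pi μ))
    (hg : ∀ i, MemLp (g i) 2 (Measure.pi μ))
    (hgi : ∀ i w x, g i (Function.update w i x) = g i w) :
    Var[f; Measure.pi μ] ≤ ∑ i, ∫ w, (f w - g i w) ^ 2 ∂(Measure.pi μ) := by
  induction n with
  | zero =>
    have hconst : f = fun _ => f default := funext fun w => congrArg f (Subsingleton.elim _ _)
    rw [hconst, Finset.univ_eq_empty, Finset.sum_empty]
    simpa using variance_le_integral_sub_const_sq (μ := Measure.pi μ)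
      (aestronglyMeasurable_const (b := f default)) (f default)
  | succ n ih =>
    have hsplit := (measurePreserving_piFinSuccAbove μ 0).symm
    set ν := Measure.pi fun j => μ (Fin.succAbove 0 j)
    set e := (MeasurableEquiv.piFinSuccAbove Ω 0).symm
    have hF : MemLp (fun z => f (e z)) 2 ((μ 0).prod ν) := hf.comp_measurePreserving hsplit
    have hG : ∀ i, MemLp (fun z => g i (e z)) 2 ((μ 0).prod ν) :=
      fun i => (hg i).comp_measurePreserving hsplit
    have hfirst : ∀ x x' y, g 0 (e (x, y)) = g 0 (e (x', y)) := fun x x' y => by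
      rw [← hgi 0 (e (x, y)) x']
      exact congrArg (g 0) (Fin.update_insertNth 0 x x' y)
    have hsection : ∀ᵐ x ∂(μ 0), Var[fun y => f (e (x, y)); ν] ≤
        ∑ i : Fin n, ∫ y, (f (e (x, y)) - g (Fin.succAbove 0 i) (e (x, y))) ^ 2 ∂ν := by
      filter_upwards [ae_memLp_two_section hF, ae_all_iff.2 fun i => ae_memLp_two_section (hG i)]
        with x hfx hgx
      refine ih hfx (fun i => hgx _) fun i y t => ?_
      rw [← hgi _ (e (x, y)) t]
      exact congrArg (g _) (Fin.insertNth_update 0 x i t y)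
    calc Var[f; Measure.pi μ]
        = Var[fun z => f (e z); (μ 0).prod ν] :=
          (hsplit.variance_fun_comp hf.1.aemeasurable).symm
      _ ≤ ∫ z, (f (e z) - g 0 (e z)) ^ 2 ∂((μ 0).prod ν) +
            ∫ x, Var[fun y => f (e (x, y)); ν] ∂(μ 0) :=
          variance_prod_le_integral_sub_sq_add hF (hG 0) hfirst
      _ ≤ ∫ z, (f (e z) - g 0 (e z)) ^ 2 ∂((μ 0).prod ν) + ∑ i : Fin n,
            ∫ z, (f (e z) - g (Fin.succAbove 0 i) (e z)) ^ 2 ∂((μ 0).prod ν) := by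
          gcongr
          exact integral_variance_section_le (f := fun z => f (e z))
            (g := fun i z => g (Fin.succAbove 0 i) (e z)) hF (fun i => hG _) hsection
      _ = ∑ i, ∫ w, (f w - g i w) ^ 2 ∂(Measure.pi μ) := by
          simp_rw [← hsplit.integral_comp' (fun w => (f w - g _ w) ^ 2)]
          rw [Fin.sum_univ_succAbove _ 0]

end EfronStein

/-! ### Variance of the number of multiply occupied cells -/

/-- `i` is pivotal for `B` when `B` has at least two elements, but not after removing `i`. -/
def IsPivotal {I : Type*} (i : I) (B : Set I) : Prop :=
  B.Nontrivial ∧ ({i}ᶜ ∩ B).Subsingleton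

theorem IsPivotal.mem {I : Type*} {i : I} {B : Set I} (h : IsPivotal i B) : i ∈ B := by
  by_contra hi
  have : {i}ᶜ ∩ B = B := Set.inter_eq_right.2 fun j hj hji => hi (hji ▸ hj)
  exact h.1.not_subsingleton (this ▸ h.2)

theorem ncard_isPivotal_le_two {I : Type*} (B : Set I) : {i | IsPivotal i B}.ncard ≤ 2 := by
  by_cases hB : B.Nontrivial
  · obtain ⟨a, ha, b, hb, hab⟩ := hB
    refine (Set.ncard_le_ncard (t := {a, b}) fun i hi => ?_).trans (Set.ncard_pair hab).le
    by_contra hne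
    simp only [Set.mem_insert_iff, Set.mem_singleton_iff, not_or] at hne
    exact hab (hi.2 ⟨Ne.symm hne.1, ha⟩ ⟨Ne.symm hne.2, hb⟩)
  · simp [IsPivotal, hB]

theorem ncard_isPivotal_preimage_le_one {Ω I ι : Type*} [Finite ι] {A : ι → Set Ω}
    (hdisj : Pairwise (Function.onFun Disjoint A)) (i : I) (s : I → Ω) :
    {r | IsPivotal i (s ⁻¹' A r)}.ncard ≤ 1 :=
  (Set.ncard_le_one_iff (Set.toFinite _)).2 fun hr hr' =>
    hdisj.eq fun hd => Set.disjoint_left.1 hd hr.mem hr'.mem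

theorem sum_ncard_comm {I ι : Type*} [Fintype I] [Fintype ι] (R : I → ι → Prop) :
    ∑ i, {r | R i r}.ncard = ∑ r, {i | R i r}.ncard := by
  classical
  simpa [Set.ncard_eq_toFinset_card', Finset.bipartiteAbove, Finset.bipartiteBelow] using
    Finset.sum_card_bipartiteAbove_eq_sum_card_bipartiteBelow (s := Finset.univ)
      (t := Finset.univ) R

noncomputable section

/-- The number of cells `A r` that receive at least two of the points `s i` with `i ∈ J`, as a
function of the sample `s`. -/
def multipleHitCount {Ω ι : Type*} [Fintype ι] {n : ℕ} (A : ι → Set Ω) (J : Set (Fin n)) :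
    (Fin n → Ω) → ℝ :=
  ∑ r, {s | (J ∩ s ⁻¹' A r).Nontrivial}.indicator 1

end

section Counting

variable {Ω ι : Type*} [Fintype ι] {n : ℕ} {A : ι → Set Ω}

theorem multipleHitCount_apply (J : Set (Fin n)) (s : Fin n → Ω) :
    multipleHitCount A J s = {r | (J ∩ s ⁻¹' A r).Nontrivial}.ncard := by
  classical
  simp [multipleHitCount, Set.indicator_apply, Set.ncard_eq_toFinset_card']

theorem multipleHitCount_univ_sub (i : Fin n) (s : Fin n → Ω) :
    multipleHitCount A Set.univ s - multipleHitCount A {i}ᶜ s =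
      {r | IsPivotal i (s ⁻¹' A r)}.ncard := by
  have hsub : {r | ({i}ᶜ ∩ s ⁻¹' A r).Nontrivial} ⊆ {r | (s ⁻¹' A r).Nontrivial} :=
    Set.ofPred_subset_ofPred_of_imp fun r hr => hr.mono Set.inter_subset_right
  simp only [multipleHitCount_apply, Set.univ_inter]
  rw [sub_eq_iff_eq_add, ← Nat.cast_add, ← Set.ncard_sdiff_add_ncard_of_subset hsub]
  simp only [IsPivotal, ← Set.not_nontrivial_iff]
  rfl

theorem multipleHitCount_update (i : Fin n) (s : Fin n → Ω) (x : Ω) :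
    multipleHitCount A {i}ᶜ (Function.update s i x) = multipleHitCount A {i}ᶜ s := by
  have hpre : ∀ B : Set Ω, {i}ᶜ ∩ Function.update s i x ⁻¹' B = {i}ᶜ ∩ s ⁻¹' B := fun B => by
    ext j
    simp +contextual [Function.update_of_ne]
  simp only [multipleHitCount_apply, hpre]

theorem sum_sq_multipleHitCount_univ_sub_le (hdisj : Pairwise (Function.onFun Disjoint A))
    (s : Fin n → Ω) :
    ∑ i, (multipleHitCount A Set.univ s - multipleHitCount A {i}ᶜ s) ^ 2 ≤
      2 * Fintype.card ι := by
  have hsq : ∀ i, {r | IsPivotal i (s ⁻¹' A r)}.ncard ^ 2 ≤ {r | IsPivotal i (s ⁻¹' A r)}.ncard :=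
    fun i => pow_le_of_le_one zero_le (ncard_isPivotal_preimage_le_one hdisj i s) two_ne_zero
  have hcount : ∑ i, {r | IsPivotal i (s ⁻¹' A r)}.ncard ^ 2 ≤ 2 * Fintype.card ι :=
    calc ∑ i, {r | IsPivotal i (s ⁻¹' A r)}.ncard ^ 2
        ≤ ∑ i, {r | IsPivotal i (s ⁻¹' A r)}.ncard := Finset.sum_le_sum fun i _ => hsq i
      _ = ∑ r, {i | IsPivotal i (s ⁻¹' A r)}.ncard := sum_ncard_comm _
      _ ≤ ∑ _ : ι, 2 := Finset.sum_le_sum fun r _ => ncard_isPivotal_le_two _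
      _ = 2 * Fintype.card ι := by simp [mul_comm]
  simp only [multipleHitCount_univ_sub]
  exact_mod_cast hcount

end Counting

section Occupancy

variable {Ω : Type*} [MeasurableSpace Ω]

theorem measureReal_pi_preimage_eq {I : Type*} [Fintype I] (ν : Measure Ω) [IsProbabilityMeasure ν]
    {A : Set Ω} (hA : MeasurableSet A) (T : Finset I) :
    (Measure.pi fun _ : I => ν).real {s | s ⁻¹' A = T} =
      ν.real A ^ T.card * (1 - ν.real A) ^ (Fintype.card I - T.card) := by
  classical
  have hbox : {s : I → Ω | s ⁻¹' A = T} =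
      Set.univ.pi fun i => if i ∈ T then A else Aᶜ := by
    ext s
    simp only [Set.mem_ofPred_eq, Set.ext_iff, Set.mem_preimage, SetLike.mem_coe, Set.mem_univ_pi]
    refine forall_congr' fun i => ?_
    split_ifs with hi <;> simp [hi]
  rw [hbox, measureReal_def, Measure.pi_pi, ENNReal.toReal_prod]
  simp only [apply_ite ν, apply_ite ENNReal.toReal, ← measureReal_def,
    probReal_compl_eq_one_sub hA, Finset.prod_ite, Finset.prod_const]
  simp [Finset.filter_not, Finset.card_sdiff]

theorem measurableSet_preimage_eq {I : Type*} [Countable I] {A : Set Ω} (hA : MeasurableSet A)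
    (T : Set I) : MeasurableSet {s : I → Ω | s ⁻¹' A = T} := by
  simp only [Set.ext_iff, Set.mem_preimage]
  measurability

theorem measurableSet_preimage_inter_nontrivial {n : ℕ} {A : Set Ω} (hA : MeasurableSet A)
    (J : Set (Fin n)) : MeasurableSet {s : Fin n → Ω | (J ∩ s ⁻¹' A).Nontrivial} := by
  simp only [Set.Nontrivial]
  measurability

theorem measureReal_pi_preimage_subsingleton {n : ℕ} (ν : Measure Ω) [IsProbabilityMeasure ν]
    {A : Set Ω} (hA : MeasurableSet A) :
    (Measure.pi fun _ : Fin n => ν).real {s | (s ⁻¹' A).Subsingleton} =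
      atMostOneProb n (ν.real A) := by
  have hunion : {s : Fin n → Ω | (s ⁻¹' A).Subsingleton} =
      ⋃ o : Option (Fin n), {s | s ⁻¹' A = o.toFinset} := by
    ext s
    simp [Option.exists, Set.subsingleton_iff_eq_empty_or_singleton]
  have hdisj : Pairwise (Function.onFun Disjoint fun o : Option (Fin n) =>
      {s : Fin n → Ω | s ⁻¹' A = o.toFinset}) := by
    refine fun o o' hne => Set.disjoint_left.2 fun s ho ho' => hne ?_
    have hfinset : o.toFinset = o'.toFinset := Finset.coe_injective (ho.symm.trans ho')
    exact Option.ext fun i => 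
      Option.mem_toFinset.symm.trans ((Finset.ext_iff.1 hfinset i).trans Option.mem_toFinset)
  rw [hunion, measureReal_iUnion_fintype hdisj fun o => measurableSet_preimage_eq hA _]
  simp [measureReal_pi_preimage_eq ν hA, atMostOneProb, mul_assoc]

variable {ι : Type*} [Fintype ι] {n : ℕ} {A : ι → Set Ω}

theorem memLp_multipleHitCount {P : Measure (Fin n → Ω)} [IsFiniteMeasure P]
    (hA : ∀ r, MeasurableSet (A r)) (J : Set (Fin n)) : MemLp (multipleHitCount A J) 2 P :=
  memLp_finsetSum' _ fun r _ => memLp_indicator_const 2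
    (measurableSet_preimage_inter_nontrivial (hA r) J) 1 (.inr (measure_ne_top _ _))

theorem integral_multipleHitCount_univ (ν : Measure Ω) [IsProbabilityMeasure ν]
    (hA : ∀ r, MeasurableSet (A r)) :
    ∫ s, multipleHitCount A (n := n) Set.univ s ∂(Measure.pi fun _ => ν) =
      ∑ r, (1 - atMostOneProb n (ν.real (A r))) := by
  have hmeas := fun r => measurableSet_preimage_inter_nontrivial (n := n) (hA r) Set.univ
  simp only [multipleHitCount, Finset.sum_apply]
  rw [integral_finsetSum _ fun r _ => (integrable_const 1).indicator (hmeas r)]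
  refine Finset.sum_congr rfl fun r _ => ?_
  rw [integral_indicator_one (hmeas r), ← measureReal_pi_preimage_subsingleton ν (hA r)]
  simp only [Set.univ_inter, ← Set.not_nontrivial_iff, ← Set.compl_ofPred] at hmeas ⊢
  rw [probReal_compl_eq_one_sub (hmeas r), sub_sub_cancel]

/-- Efron–Stein with the counts that ignore the `i`-th point: that point matters only in the cell
containing it, and each cell has at most two points that matter. -/
theorem variance_multipleHitCount_univ_le (ν : Measure Ω) [IsProbabilityMeasure ν]
    (hA : ∀ r, MeasurableSet (A r)) (hdisj : Pairwise (Function.onFun Disjoint A)) :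
    Var[multipleHitCount A (n := n) Set.univ; Measure.pi fun _ => ν] ≤ 2 * Fintype.card ι := by
  have hintegrable : ∀ i : Fin n, Integrable
      (fun s => (multipleHitCount A Set.univ s - multipleHitCount A {i}ᶜ s) ^ 2)
      (Measure.pi fun _ => ν) :=
    fun i => ((memLp_multipleHitCount hA _).sub (memLp_multipleHitCount hA _)).integrable_sq
  refine (variance_pi_le_sum_integral_sub_sq (memLp_multipleHitCount hA _)
    (fun i => memLp_multipleHitCount hA {i}ᶜ) multipleHitCount_update).trans ?_
  rw [← integral_finsetSum _ fun i _ => hintegrable i]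
  refine (integral_mono (integrable_finsetSum _ fun i _ => hintegrable i) (integrable_const _)
    (sum_sq_multipleHitCount_univ_sub_le hdisj)).trans ?_
  simp

end Occupancy

/-! ### Concentration of the fillup level -/

theorem measurableSet_isPrefix {k : ℕ} (r : Fin k → Bool) :
    MeasurableSet {x : ℕ → Bool | IsPrefix r x} := by
  unfold IsPrefix
  measurability

theorem pairwise_disjoint_isPrefix (k : ℕ) :
    Pairwise (Function.onFun Disjoint fun r : Fin k → Bool => {x : ℕ → Bool | IsPrefix r x}) :=
  fun _ _ hne => Set.disjoint_left.2 fun _ hx hx' =>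
    hne (funext fun j => (hx j).symm.trans (hx' j))

theorem stringLaw_real_isPrefix (p : unitInterval) {k : ℕ} (r : Fin k → Bool) :
    (stringLaw p).real {x | IsPrefix r x} = ∏ j, if r j then (p : ℝ) else 1 - p := by
  set t : ℕ → Set Bool := fun i => {b | ∀ h : i < k, b = r ⟨i, h⟩} with ht
  have hpi : {x | IsPrefix r x} = ((Finset.range k : Finset ℕ) : Set ℕ).pi t := by
    ext x
    simp [IsPrefix, ht, Set.mem_pi, Fin.forall_iff]
  have ht_singleton : ∀ j : Fin k, t j = {r j} := fun j => by
    ext b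
    simp [ht]
  have hbit : ∀ b, (bernoulliMeasure true false p).real {b} = if b then (p : ℝ) else 1 - p := by
    rintro (_ | _)
    · rw [bernoulliMeasure_real_apply_of_notMem_of_mem p (measurableSet_singleton _) (by simp)
        (by simp)]
      simp
    · rw [bernoulliMeasure_real_apply_of_mem_of_notMem p (measurableSet_singleton _) (by simp)
        (by simp)]
      simp
  rw [hpi, measureReal_def, stringLaw, Measure.infinitePi_pi _ fun _ _ => .of_discrete,
    ENNReal.toReal_prod, Finset.prod_range]
  exact Finset.prod_congr rfl fun j _ => by rw [ht_singleton, ← measureReal_def, hbit]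

theorem fillProportion_eq_multipleHitCount_div {n : ℕ} (s : Fin n → ℕ → Bool) (k : ℕ) :
    fillProportion s k =
      multipleHitCount (fun r : Fin k → Bool => {x | IsPrefix r x}) Set.univ s / 2 ^ k := by
  have hnode : ∀ r : Fin k → Bool,
      IsInternalNode s r ↔ (s ⁻¹' {x | IsPrefix r x}).Nontrivial := fun r => by
    simp only [IsInternalNode, Set.Nontrivial, Set.mem_preimage, Set.mem_ofPred_eq]
    grind
  rw [fillProportion, internalCount, multipleHitCount_apply, ← Nat.card_coe_set_eq]
  simp only [hnode, Set.univ_inter]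
  rfl

theorem integral_fillProportion (p : unitInterval) (n k : ℕ) :
    ∫ s, fillProportion s k ∂(sampleLaw p n) = meanFill p (1 - p) n k := by
  simp only [fillProportion_eq_multipleHitCount_div, integral_div, sampleLaw,
    integral_multipleHitCount_univ (stringLaw p) measurableSet_isPrefix, stringLaw_real_isPrefix,
    meanFill, cellAverage]

theorem memLp_fillProportion (p : unitInterval) (n k : ℕ) :
    MemLp (fun s => fillProportion s k) 2 (sampleLaw p n) := by
  simp only [fillProportion_eq_multipleHitCount_div, div_eq_mul_inv]
  exact (memLp_multipleHitCount measurableSet_isPrefix _).mul_const _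

theorem variance_fillProportion_le (p : unitInterval) (n k : ℕ) :
    Var[fun s => fillProportion s k; sampleLaw p n] ≤ 2 / 2 ^ k := by
  simp only [fillProportion_eq_multipleHitCount_div, div_eq_mul_inv]
  rw [variance_mul_const]
  calc _ ≤ 2 * (Fintype.card (Fin k → Bool) : ℝ) * ((2 ^ k : ℝ)⁻¹) ^ 2 := by
        gcongr
        exact variance_multipleHitCount_univ_le (stringLaw p) measurableSet_isPrefix
          (pairwise_disjoint_isPrefix k)
    _ = 2 * (2 ^ k)⁻¹ := by
        simp
        field_simp

theorem internalCount_succ_le {n : ℕ} (s : Fin n → ℕ → Bool) (k : ℕ) :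
    internalCount s (k + 1) ≤ 2 * internalCount s k := by
  let parent : {r : Fin (k + 1) → Bool // IsInternalNode s r} →
      Bool × {r : Fin k → Bool // IsInternalNode s r} := fun r =>
    (r.1 (Fin.last k), ⟨Fin.init r.1,
      let ⟨i, j, hij, hi, hj⟩ := r.2
      ⟨i, j, hij, fun l => hi l.castSucc, fun l => hj l.castSucc⟩⟩)
  have hparent : Function.Injective parent := fun a b hab => by
    have hlast : a.1 (Fin.last k) = b.1 (Fin.last k) := congrArg Prod.fst hab
    have hinit : Fin.init a.1 = Fin.init b.1 := congrArg (fun x => x.2.1) hab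
    rw [Subtype.ext_iff, ← Fin.snoc_init_self a.1, ← Fin.snoc_init_self b.1, hlast, hinit]
  simpa [internalCount] using Nat.card_le_card_of_injective parent hparent

theorem antitone_fillProportion {n : ℕ} (s : Fin n → ℕ → Bool) : Antitone (fillProportion s) := by
  refine antitone_nat_of_succ_le fun k => ?_
  have h : (internalCount s (k + 1) : ℝ) ≤ 2 * internalCount s k := by
    exact_mod_cast internalCount_succ_le s k
  calc fillProportion s (k + 1) ≤ 2 * internalCount s k / 2 ^ (k + 1) := by
        unfold fillProportion
        gcongr
    _ = fillProportion s k := by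
        rw [fillProportion, pow_succ', mul_div_mul_left _ _ two_ne_zero]

theorem fillupLevel_eq_or_eq_add_one {n : ℕ} (hn : 2 ≤ n) {α : ℝ} (hα0 : 0 < α) (hα1 : α ≤ 1)
    {s : Fin n → ℕ → Bool} {k : ℕ} (hk : α ≤ fillProportion s k)
    (hk2 : fillProportion s (k + 2) < α) :
    fillupLevel α s = k ∨ fillupLevel α s = k + 1 := by
  obtain ⟨hmem, hub⟩ := isGreatest_fillupLevel hn hα0 hα1 s
  have hle : k ≤ fillupLevel α s := hub hk
  have hlt : fillupLevel α s < k + 2 := by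
    by_contra! h
    exact (hk2.trans_le hmem).not_ge (antitone_fillProportion s h)
  lia

theorem measureReal_le_abs_fillProportion_sub_le (p : unitInterval) (n k : ℕ) {δ : ℝ}
    (hδ : 0 < δ) :
    (sampleLaw p n).real {s | δ ≤ |fillProportion s k - meanFill p (1 - p) n k|} ≤
      2 / (2 ^ k * δ ^ 2) := by
  have h := meas_ge_le_variance_div_sq (memLp_fillProportion p n k) hδ
  rw [integral_fillProportion] at h
  refine (ENNReal.toReal_le_of_le_ofReal
    (div_nonneg (variance_nonneg _ _) (sq_nonneg δ)) h).trans ?_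
  rw [← div_div]
  gcongr
  exact variance_fillProportion_le p n k

theorem one_sub_le_measureReal_fillupLevel (p : unitInterval) {n k : ℕ} (hn : 2 ≤ n) {α δ : ℝ}
    (hα0 : 0 < α) (hα1 : α ≤ 1) (hδ : 0 < δ) (hk : α + δ ≤ meanFill p (1 - p) n k)
    (hk2 : meanFill p (1 - p) n (k + 2) ≤ α - δ) :
    1 - 4 / (2 ^ k * δ ^ 2) ≤
      (sampleLaw p n).real {s | fillupLevel α s = k ∨ fillupLevel α s = k + 1} := by
  let good : Set (Fin n → ℕ → Bool) := {s | fillupLevel α s = k ∨ fillupLevel α s = k + 1}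
  let deviant (l : ℕ) : Set (Fin n → ℕ → Bool) :=
    {s | δ ≤ |fillProportion s l - meanFill p (1 - p) n l|}
  have hcover : Set.univ ⊆ good ∪ (deviant k ∪ deviant (k + 2)) := fun s _ => by
    by_contra! hs
    simp only [Set.mem_union, not_or, good, deviant, Set.mem_ofPred_eq, not_le, abs_lt] at hs
    exact not_or.2 hs.1
      (fillupLevel_eq_or_eq_add_one hn hα0 hα1 (by linarith) (by linarith))
  have hdeviant : (sampleLaw p n).real (deviant (k + 2)) ≤ 2 / (2 ^ k * δ ^ 2) :=
    (measureReal_le_abs_fillProportion_sub_le p n (k + 2) hδ).trans (by gcongr <;> simp)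
  have hprob : (1 : ℝ) ≤ (sampleLaw p n).real good +
      (2 / (2 ^ k * δ ^ 2) + 2 / (2 ^ k * δ ^ 2)) :=
    calc (1 : ℝ) = (sampleLaw p n).real Set.univ := probReal_univ.symm
      _ ≤ (sampleLaw p n).real (good ∪ (deviant k ∪ deviant (k + 2))) := measureReal_mono hcover
      _ ≤ (sampleLaw p n).real good +
            ((sampleLaw p n).real (deviant k) + (sampleLaw p n).real (deviant (k + 2))) :=
          (measureReal_union_le _ _).trans (by gcongr; exact measureReal_union_le _ _)
      _ ≤ _ := by
          gcongr
          exact measureReal_le_abs_fillProportion_sub_le p n k hδ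
  linear_combination hprob

theorem tendsto_measure_fillupLevel (p : unitInterval) {α : ℝ} (hα0 : 0 < α) (hα1 : α ≤ 1)
    {k : ℕ → ℕ} {δ : ℕ → ℝ} (hδ : ∀ᶠ n in atTop, 0 < δ n)
    (hlim : Tendsto (fun n => 2 ^ k n * δ n ^ 2) atTop atTop)
    (hk : ∀ᶠ n in atTop, α + δ n ≤ meanFill p (1 - p) n (k n) ∧
      meanFill p (1 - p) n (k n + 2) ≤ α - δ n) :
    Tendsto (fun n => sampleLaw p n {s | fillupLevel α s = k n ∨ fillupLevel α s = k n + 1})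
      atTop (𝓝 1) := by
  have hbound : Tendsto (fun n => 1 - 4 / (2 ^ k n * δ n ^ 2)) atTop (𝓝 1) := by
    simpa using (hlim.const_div_atTop 4).const_sub 1
  rw [← ENNReal.tendsto_toReal_iff (fun _ => measure_ne_top _ _) ENNReal.one_ne_top,
    ENNReal.toReal_one]
  refine tendsto_of_tendsto_of_tendsto_of_le_of_le' hbound tendsto_const_nhds ?_
    (.of_forall fun _ => measureReal_le_one)
  filter_upwards [eventually_ge_atTop 2, hδ, hk] with n hn hδn hkn
  exact one_sub_le_measureReal_fillupLevel p hn hα0 hα1 hδn hkn.1 hkn.2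

theorem tendsto_two_pow_mul_sq_one_div_log {p q a : ℝ} (hp : 0 < p) (hq : 0 < q) (hpq : p + q = 1)
    {k : ℕ → ℕ}
    (hk : (fun n => (k n : ℝ) - criticalLevel p q a n) =O[atTop] fun _ => (1 : ℝ)) :
    Tendsto (fun n : ℕ => (2 : ℝ) ^ k n * (1 / Real.log n) ^ 2) atTop atTop := by
  obtain ⟨T, hT⟩ := hk.bound
  set c := Real.log 2 / (2 * levelRate p q) with hc
  have hc_pos : 0 < c := div_pos (Real.log_pos one_lt_two) (by
    have := levelRate_pos hp hq hpq
    positivity)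
  have hgrowth : Tendsto (fun n : ℕ =>
      Real.exp (-(Real.log 2 * T)) * (Real.exp (c * Real.log n) / Real.log n ^ (2 : ℝ)))
      atTop atTop :=
    ((tendsto_exp_mul_div_rpow_atTop 2 c hc_pos).comp
      (Real.tendsto_log_atTop.comp tendsto_natCast_atTop_atTop)).const_mul_atTop (Real.exp_pos _)
  refine tendsto_atTop_mono' _ ?_ hgrowth
  filter_upwards [hT, eventually_log_div_le_criticalLevel hp hq hpq a] with n hn hcrit
  have hlevel : c * Real.log n - Real.log 2 * T ≤ Real.log 2 * k n := by
    rw [norm_one, mul_one, Real.norm_eq_abs, abs_le] at hn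
    have : Real.log n / (2 * levelRate p q) - T ≤ k n := by linarith
    calc c * Real.log n - Real.log 2 * T
        = Real.log 2 * (Real.log n / (2 * levelRate p q) - T) := by rw [hc]; ring
      _ ≤ Real.log 2 * k n := by gcongr
  calc Real.exp (-(Real.log 2 * T)) * (Real.exp (c * Real.log n) / Real.log n ^ (2 : ℝ))
      = Real.exp (c * Real.log n - Real.log 2 * T) * (1 / Real.log n) ^ 2 := by
        rw [Real.rpow_two, sub_eq_add_neg, Real.exp_add]
        ring
    _ ≤ Real.exp (Real.log 2 * k n) * (1 / Real.log n) ^ 2 := by gcongr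
    _ = (2 : ℝ) ^ k n * (1 / Real.log n) ^ 2 := by
        rw [Real.exp_mul, Real.exp_log two_pos, Real.rpow_natCast]

end Trie

theorem theorem1 (α : ℝ) (hα0 : 0 < α) (hα1 : α < 1)
    (p : unitInterval) (hp0 : 0 < (p : ℝ)) (hp1 : (p : ℝ) < 1)
    (q : ℝ) (hq : q = 1 - (p : ℝ)) :
    ∃ k : ℕ → ℕ,
      ((fun n : ℕ => (k n : ℝ) -
          (Real.logb (1 / √((p : ℝ) * q)) n -
            |Real.log ((p : ℝ) / q)| / (2 * Real.log (1 / √((p : ℝ) * q)) ^ (3 / 2 : ℝ)) *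
              Trie.normalQuantile α * √(Real.log n)))
        =O[atTop] (fun _ : ℕ => (1 : ℝ))) ∧
      Tendsto (fun n : ℕ => Trie.sampleLaw p n
          {s | Trie.fillupLevel α s = k n ∨ Trie.fillupLevel α s = k n + 1})
        atTop (𝓝 1) ∧
      ((p : ℝ) ≠ 1 / 2 →
        (fun n : ℕ => (∫ s, Trie.fillProportion s (k n) ∂(Trie.sampleLaw p n)) - α)
          =O[atTop] (fun n : ℕ => 1 / √(Real.logb 2 n))) := by
  subst hq
  have ha := Trie.normalCDF_normalQuantile hα0 hα1
  have hq0 : 0 < 1 - (p : ℝ) := sub_pos.2 hp1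
  have hpq : (p : ℝ) + (1 - p) = 1 := add_sub_cancel _ _
  obtain ⟨k, hlevel, hmargin, hmean⟩ := Trie.exists_fillupSequence hp0 hq0 hpq
    (ha.symm ▸ hα0) (ha.symm ▸ hα1)
  rw [ha] at hmargin hmean
  have hδ : ∀ᶠ n : ℕ in atTop, 0 < 1 / Real.log n :=
    (eventually_gt_atTop 1).mono fun n hn => one_div_pos.2 (Real.log_pos (Nat.one_lt_cast.2 hn))
  refine ⟨k, hlevel, ?_, fun hp => ?_⟩
  · exact Trie.tendsto_measure_fillupLevel p hα0 hα1.le hδ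
      (Trie.tendsto_two_pow_mul_sq_one_div_log hp0 hq0 hpq hlevel) hmargin
  · simpa only [Trie.integral_fillProportion] using hmean hp
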